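/- Let $P$ be a partially ordered set with underlying set $\{1,\dots,N\}$, $N\ge 1$, and order $\preceq$ (not necessarily compatible with the usual order of the integers), and let $\mathbf k$ be a field whose characteristic is $0$ or greater than $N$. Let $\mathfrak g=\mathfrak g(P)$ be the Lie poset algebra: the Lie algebra, under the commutator, of all $N\times N$ matrices over $\mathbf k$ of trace zero that are linear combinations of the matrix units $e_{ij}$ with $i\preceq j$. Let $\mathfrak h\subset\mathfrak g$ be the Abelian subalgebra of diagonal matrices of trace zero, $\mathfrak h^\vee$ its dual space, and $\mathfrak c$ the center of $\mathfrak g$. Let $\Sigma$ be the nerve of $P$, whose nondegenerate $q$-simplices are the chains $i_0\prec i_1\prec\cdots\prec i_q$, and let $\Sigma^+$ be $\Sigma$ augmented by a single simplex of dimension $-1$ that is the boundary of every $0$-simplex. Write $H^*(\Sigma,\mathbf k)$ and $H^*(\Sigma^+,\mathbf k)$ for simplicial cohomology, $H^*(\mathfrak g,\mathfrak g)$ for the Chevalley–Eilenberg cohomology of $\mathfrak g$ with coefficients in the adjoint module, and $H^*(\mathfrak h,\mathbf k)$ for that of $\mathfrak h$ with coefficients in the trivial module $\mathbf k$. Then,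 as graded $\mathbf k$-vector spaces, $$H^*(\mathfrak g,\mathfrak g)\;\cong\;\bigwedge\mathfrak h^\vee\otimes H^*(\Sigma^+,\mathbf k)\;=\;H^*(\mathfrak h,\mathbf k)\otimes H^*(\Sigma^+,\mathbf k).$$ That is, $H^{-1}(\Sigma^+,\mathbf k)=0$, and for every $n\ge 0$ $$H^n(\mathfrak g,\mathfrak g)\;\cong\;\bigoplus_{p+q=n}\bigwedge^p\mathfrak h^\vee\otimes H^q(\Sigma^+,\mathbf k)\;\cong\;\bigoplus_{p+q=n}H^p(\mathfrak h,\mathbf k)\otimes H^q(\Sigma^+,\mathbf k)\qquad(p,q\ge 0).$$ Here $\bigwedge^p\mathfrak h^\vee$ is identified with $H^p(\mathfrak h,\mathbf k)$ by the isomorphism that sends $\xi_1\wedge\cdots\wedge\xi_p$ to the class of the cocycle $(h_1,\dots,h_p)\mapsto\det(\xi_i(h_j))$. As a consequence, $$H^2(\mathfrak g,\mathfrak g)\;\cong\;\Bigl(\bigwedge^2\mathfrak h^\vee\otimes\mathfrak c\Bigr)\oplus\bigl(\mathfrak h^\vee\otimes H^1(\Sigma,\mathbf k)\bigr)\oplus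 H^2(\Sigma,\mathbf k).$$ -/

import Mathlib

open scoped TensorProduct DirectSum

/- Matrices carry the commutator bracket. -/
attribute [local instance 100] LieRing.ofAssociativeRing

namespace LiePoset

noncomputable section

/-! ### Chevalley–Eilenberg cohomology -/

section ChevalleyEilenberg

variable (k L M : Type*) [CommRing k] [LieRing L] [LieAlgebra k L]
  [AddCommGroup M] [Module k M] [LieRingModule L M] [LieModule k L M]

/-- The part `∑_{i<j} (-1)^{i+j} F([g_i, g_j], g_0, …, ĝ_i, …, ĝ_j, …, g_n)` of the
Chevalley–Eilenberg coboundary of an `n`-cochain `F` (an empty sum for `n = 0`).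
For `i : Fin (n + 1)` and `j : Fin (n + 2)` with `i < j`, the remaining arguments are obtained by
omitting first `j`, then `i`. -/
def ceBracketTerm : ∀ {n : ℕ}, (L [⋀^Fin n]→ₗ[k] M) → (Fin (n + 1) → L) → M
  | 0, _, _ => 0
  | n + 1, F, g =>
      ∑ j : Fin (n + 2), ∑ i : Fin (n + 1),
        if i.castSucc < j then
          (-1 : k) ^ ((i : ℕ) + (j : ℕ)) •
            F (Fin.cons ⁅g i.castSucc, g j⁆ fun l => g (j.succAbove (i.succAbove l)))
        else 0

/-- The Chevalley–Eilenberg coboundary `δF`, as a function of `n + 1` arguments, of an `n`-cochain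
`F : C^n(L, M)`, i.e. of an alternating `n`-linear map from `L` to `M`. -/
def ceDelta (n : ℕ) : (L [⋀^Fin n]→ₗ[k] M) →ₗ[k] ((Fin (n + 1) → L) → M) where
  toFun F g :=
    (∑ i : Fin (n + 1), (-1 : k) ^ (i : ℕ) • ⁅g i, F fun l => g (i.succAbove l)⁆)
      + ceBracketTerm k L M F g
  map_add' F G := by
    funext g
    cases n with
    | zero => simp [ceBracketTerm]
    | succ n =>
      simp only [ceBracketTerm, AlternatingMap.add_apply, lie_add, smul_add, Finset.sum_add_distrib,
        Pi.add_apply, ← Finset.sum_filter]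
      abel
  map_smul' c F := by
    funext g
    cases n with
    | zero => simp [ceBracketTerm]
    | succ n =>
      simp only [ceBracketTerm, AlternatingMap.smul_apply, lie_smul, smul_comm _ c,
        RingHom.id_apply, Pi.smul_apply, smul_add, Finset.smul_sum, ← Finset.sum_filter]

/-- The `n`-cocycles: the cochains `F` with `δF = 0`. -/
def ceCocycles (n : ℕ) : Submodule k (L [⋀^Fin n]→ₗ[k] M) :=
  LinearMap.ker (ceDelta k L M n)

/-- The `n`-coboundaries: the cochains of the form `δG` with `G` an `(n - 1)`-cochain. -/
def ceCoboundaries : ∀ n : ℕ, Submodule k (L [⋀^Fin n]→ₗ[k] M)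
  | 0 => ⊥
  | n + 1 =>
    { carrier := {F | ∃ G : L [⋀^Fin n]→ₗ[k] M, ∀ g : Fin (n + 1) → L, F g = ceDelta k L M n G g}
      add_mem' := by
        rintro _ _ ⟨G, hG⟩ ⟨G', hG'⟩
        exact ⟨G + G', fun g => by simp [hG, hG']⟩
      zero_mem' := ⟨0, fun g => by simp⟩
      smul_mem' := by
        rintro c _ ⟨G, hG⟩
        exact ⟨c • G, fun g => by simp [hG]⟩ }

/-- The Chevalley–Eilenberg cohomology `H^n(L, M)`: cocycles modulo coboundaries. -/
abbrev ceCohomology (n : ℕ) : Type _ :=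
  ceCocycles k L M n ⧸ (ceCoboundaries k L M n).submoduleOf (ceCocycles k L M n)

end ChevalleyEilenberg

/-! ### Simplicial cohomology of the nerve of a poset -/

section Nerve

variable (k P : Type*) [CommRing k] [PartialOrder P]

/-- The nondegenerate simplices of the nerve of `P` with `m` vertices (so of dimension `m - 1`):
the chains `c 0 < c 1 < ⋯ < c (m - 1)`. For `m = 0` there is exactly one, the empty
simplex, which has dimension `-1`. -/
def Chain (m : ℕ) : Type _ := {c : Fin m → P // StrictMono c}

variable {P} in
/-- The face of a simplex opposite to its `i`-th vertex. -/
def Chain.face {m : ℕ} (c : Chain P (m + 1)) (i : Fin (m + 1)) : Chain P m :=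
  ⟨fun l => c.1 (i.succAbove l), c.2.comp i.strictMono_succAbove⟩

/-- The simplicial coboundary, from functions on simplices with `m` vertices to functions on
simplices with `m + 1` vertices. For `m = 0` the unique `(-1)`-simplex is the boundary of
every `0`-simplex. -/
def nerveDelta (m : ℕ) : (Chain P m → k) →ₗ[k] (Chain P (m + 1) → k) where
  toFun f c := ∑ i : Fin (m + 1), (-1 : k) ^ (i : ℕ) * f (c.face i)
  map_add' f g := by
    funext c
    simp [mul_add, Finset.sum_add_distrib]
  map_smul' a f := by
    funext c
    simp [Finset.mul_sum, mul_left_comm]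

/-- The coboundaries of the nerve `Σ` in degree `q`. -/
def nerveCoboundaries : ∀ q : ℕ, Submodule k (Chain P (q + 1) → k)
  | 0 => ⊥
  | q + 1 => LinearMap.range (nerveDelta k P (q + 1))

/-- `H^q(Σ, k)`, the simplicial cohomology of the nerve `Σ` of `P`, for `q ≥ 0`. -/
abbrev nerveCohomology (q : ℕ) : Type _ :=
  LinearMap.ker (nerveDelta k P (q + 1)) ⧸
    (nerveCoboundaries k P q).submoduleOf (LinearMap.ker (nerveDelta k P (q + 1)))

/-- `H^q(Σ⁺, k)` for `q ≥ 0`, where `Σ⁺` is the nerve augmented by a single simplex of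
dimension `-1`. -/
abbrev augNerveCohomology (q : ℕ) : Type _ :=
  LinearMap.ker (nerveDelta k P (q + 1)) ⧸
    (LinearMap.range (nerveDelta k P q)).submoduleOf (LinearMap.ker (nerveDelta k P (q + 1)))

/-- `H^{-1}(Σ⁺, k)`: there are no cochains in degree `-2`, so this is just the space of cocycles
in degree `-1`. -/
abbrev augNerveCohomologyNegOne : Type _ := LinearMap.ker (nerveDelta k P 0)

end Nerve

/-! ### Lie poset algebras -/

section Algebra

variable (k P : Type*) [CommRing k] [Fintype P] [DecidableEq P]

/-- The Lie poset algebra `𝔤(P)`: the Lie algebra, under the commutator of matrices, of the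
combinations of trace zero of the matrix units `e_{ij}` with `i ≤ j` in `P`. -/
def lieAlg [PartialOrder P] : LieSubalgebra k (Matrix P P k) where
  carrier := {A | (∀ i j, ¬ i ≤ j → A i j = 0) ∧ A.trace = 0}
  add_mem' := by
    rintro A B ⟨hA, hA'⟩ ⟨hB, hB'⟩
    exact ⟨fun i j h => by simp [hA i j h, hB i j h], by simp [hA', hB']⟩
  zero_mem' := by simp
  smul_mem' := by
    rintro c A ⟨hA, hA'⟩
    exact ⟨fun i j h => by simp [hA i j h], by simp [hA']⟩
  lie_mem' := by
    rintro A B ⟨hA, -⟩ ⟨hB, -⟩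
    have key : ∀ {X Y : Matrix P P k}, (∀ i j, ¬ i ≤ j → X i j = 0) →
        (∀ i j, ¬ i ≤ j → Y i j = 0) → ∀ i j, ¬ i ≤ j → (X * Y) i j = 0 := by
      intro X Y hX hY i j h
      rw [Matrix.mul_apply]
      refine Finset.sum_eq_zero fun l _ => ?_
      by_cases h₁ : i ≤ l
      · rw [hY l j fun h₂ => h (h₁.trans h₂), mul_zero]
      · rw [hX i l h₁, zero_mul]
    refine ⟨fun i j h => ?_, ?_⟩
    · rw [Ring.lie_def, Matrix.sub_apply, key hA hB i j h, key hB hA i j h, sub_zero]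
    · rw [Ring.lie_def, Matrix.trace_sub, Matrix.trace_mul_comm, sub_self]

/-- The Cartan subalgebra `𝔥`: the diagonal matrices of trace zero. -/
def cartan : LieSubalgebra k (Matrix P P k) where
  carrier := {A | A.IsDiag ∧ A.trace = 0}
  add_mem' := by
    rintro A B ⟨hA, hA'⟩ ⟨hB, hB'⟩
    exact ⟨hA.add hB, by simp [hA', hB']⟩
  zero_mem' := by simp [Matrix.isDiag_zero]
  smul_mem' := by
    rintro c A ⟨hA, hA'⟩
    exact ⟨hA.smul c, by simp [hA']⟩
  lie_mem' := by
    rintro A B ⟨hA, -⟩ ⟨hB, -⟩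
    refine ⟨?_, ?_⟩
    · rw [Ring.lie_def, ← hA.diagonal_diag, ← hB.diagonal_diag, Matrix.diagonal_mul_diagonal,
        Matrix.diagonal_mul_diagonal]
      exact (Matrix.isDiag_diagonal _).sub (Matrix.isDiag_diagonal _)
    · rw [Ring.lie_def, Matrix.trace_sub, Matrix.trace_mul_comm, sub_self]

/-- `H^n(𝔤(P), 𝔤(P))`: Chevalley–Eilenberg cohomology with adjoint coefficients. -/
abbrev adjointCohomology [PartialOrder P] (n : ℕ) : Type _ :=
  ceCohomology k (lieAlg k P) (lieAlg k P) n

/-- `H^p(𝔥, k)`: Chevalley–Eilenberg cohomology of `𝔥` with coefficients in the trivial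
module `k`. -/
abbrev cartanCohomology (p : ℕ) : Type _ :=
  ceCohomology k (cartan k P) (TrivialLieModule k (cartan k P) k) p

/-- The exterior power `⋀^p 𝔥^∨` of the dual space of `𝔥`. -/
abbrev cartanDualPower (p : ℕ) : Type _ :=
  ⋀[k]^p (Module.Dual k (cartan k P))

end Algebra

end

end LiePoset

/-! Every space involved is finite-dimensional, so the isomorphisms for $H^*(\mathfrak g,\mathfrak
g)$ reduce to equalities of dimensions; only $\bigwedge^p\mathfrak h^\vee\cong H^p(\mathfrak
h,\mathbf k)$ is built explicitly, and there all coboundaries vanish. The dimension count is a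
Hochschild–Serre reduction with respect to the torus $\mathfrak h$.

Since $N$ is invertible, the diagonal units project to elements `cartanEl` of $\mathfrak h$, which
act diagonalizably on cochains with integer weights. By Cartan's formula $\iota_x d+d\iota_x=L_x$
this action is zero on cohomology, so invariant cochains suffice (`cohomDim_invForms`). On them
$\iota_x$ anticommutes with $d$, and so does $\xi\wedge$ for a form $\xi$ dual to $x$ that vanishes
on brackets. The complex therefore splits as $K'\oplus\xi\wedge K'$, and each of $N-1$ independent
directions of $\mathfrak h$ contributes a factor $1+X$ to the generating function of dimensions
(`cohomSeries_relForms`). This accounts for $\bigwedge\mathfrak h^\vee$.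

What remains are the relative cochains: invariant, and killed by contraction with $\mathfrak h$.
Such a cochain is determined by its values on the units $e_{ij}$, $i\prec j$, and invariance kills
the $(a,b)$ entry unless the edges $(i,j)$ have the boundary of a path from $a$ to $b$. This balance
holds a priori only in $\mathbf k$, but the counts are at most $N$, so the hypothesis on the
characteristic makes it an equality of integers; acyclicity of the order then forces the edges to
form a chain (`exists_chain_of_flow`). Evaluation on chains (`chainEval`) is thus an injective
cochain map to the cochains of the nerve. It is onto in positive degrees, while in degree $0$ its
image is the functions of sum zero, a complement of the constants. Dividing out the constants is
what the $(-1)$-simplex of $\Sigma^+$ does. -/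

namespace LiePoset

/-! ### Cartan calculus on Chevalley–Eilenberg cochains -/

section CartanCalculus

variable {k L M : Type*} [CommRing k] [LieRing L] [LieAlgebra k L]
  [AddCommGroup M] [Module k M]

/-- The sum `∑ F (g₀, …, φ g_l, …, g_{n-1})`, the derivation action of `φ` on a form. -/
def derivForm {n : ℕ} (φ : L →ₗ[k] L) (F : L [⋀^Fin n]→ₗ[k] M) : L [⋀^Fin n]→ₗ[k] M where
  toMultilinearMap := ∑ l : Fin n,
    F.toMultilinearMap.compLinearMap (Function.update (fun _ => LinearMap.id) l φ)
  map_eq_zero_of_eq' := by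
    intro v i j hv hij
    have key : ∀ l, (fun a => (Function.update (fun _ => LinearMap.id) l φ :
        Fin n → (L →ₗ[k] L)) a (v a)) = Function.update v l (φ (v l)) := by
      intro l
      funext a
      rcases eq_or_ne a l with rfl | h
      · simp
      · simp [h]
    simp only [MultilinearMap.toFun_eq_coe, sum_apply,
      MultilinearMap.compLinearMap_apply, key, AlternatingMap.coe_multilinearMap]
    -- If the arguments at `i` and `j` agree, only the terms that modify one of these two slots
    -- survive; they differ by a transposition and cancel.
    rw [Fintype.sum_eq_add i j hij]
    · have h2 := F.map_swap (Function.update v i (φ (v i))) hij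
      have h3 : (Function.update v i (φ (v i)) ∘ Equiv.swap i j)
          = Function.update v j (φ (v j)) := by
        funext a
        simp only [Function.comp_apply, Function.update_apply, Equiv.swap_apply_def]
        split_ifs <;> simp_all
      rw [h3] at h2
      rw [h2]; simp
    · rintro l ⟨h1, h2⟩
      exact F.map_eq_zero_of_eq _ (by simp [h1.symm, h2.symm, hv]) hij

theorem derivForm_apply {n : ℕ} (φ : L →ₗ[k] L) (F : L [⋀^Fin n]→ₗ[k] M) (g : Fin n → L) :
    derivForm φ F g = ∑ l : Fin n, F (Function.update g l (φ (g l))) := by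
  have key : ∀ l, (fun a => (Function.update (fun _ => LinearMap.id) l φ :
      Fin n → (L →ₗ[k] L)) a (g a)) = Function.update g l (φ (g l)) := by
    intro l
    funext a
    rcases eq_or_ne a l with rfl | h
    · simp
    · simp [h]
  change (∑ l : Fin n, F.toMultilinearMap.compLinearMap
    (Function.update (fun _ => LinearMap.id) l φ)) g = _
  simp [key]

/-- The contraction `ι_x` of a cochain with `x`. -/
def contr {n : ℕ} (x : L) : (L [⋀^Fin (n + 1)]→ₗ[k] M) →ₗ[k] (L [⋀^Fin n]→ₗ[k] M) where
  toFun F := F.curryLeft x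
  map_add' _ _ := rfl
  map_smul' _ _ := rfl

@[simp]
theorem contr_apply {n : ℕ} (x : L) (F : L [⋀^Fin (n + 1)]→ₗ[k] M) (g : Fin n → L) :
    contr x F g = F (Fin.cons x g) := rfl

/-- The engine of the Cartan calculus: an identity between forms is proved by induction on the
degree after contracting both sides. -/
theorem ext_contr {n : ℕ} {F G : L [⋀^Fin (n + 1)]→ₗ[k] M} (h : ∀ x, contr x F = contr x G) :
    F = G := by
  ext g
  rw [← Fin.cons_self_tail g, ← contr_apply, ← contr_apply, h]

theorem contr_add_left {n : ℕ} (x y : L) (F : L [⋀^Fin (n + 1)]→ₗ[k] M) :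
    contr (x + y) F = contr x F + contr y F :=
  F.curryLeft.map_add x y

theorem contr_smul_left {n : ℕ} (c : k) (x : L) (F : L [⋀^Fin (n + 1)]→ₗ[k] M) :
    contr (c • x) F = c • contr x F :=
  F.curryLeft.map_smul c x

theorem contr_contr_self {n : ℕ} (x : L) (F : L [⋀^Fin (n + 1 + 1)]→ₗ[k] M) :
    contr x (contr x F) = 0 :=
  F.curryLeft_same x

theorem contr_anticomm {n : ℕ} (x y : L) (F : L [⋀^Fin (n + 1 + 1)]→ₗ[k] M) :
    contr x (contr y F) = - contr y (contr x F) := by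
  have h := contr_contr_self (x + y) F
  simp only [contr_add_left, map_add, contr_contr_self, zero_add, add_zero] at h
  exact eq_neg_of_add_eq_zero_right h

theorem neg_one_pow_smul_eq (n : ℕ) (m : M) : ((-1 : k) ^ n) • m = ((-1 : ℤ) ^ n) • m := by
  rw [← Int.cast_smul_eq_zsmul k]
  simp

theorem neg_one_pow_smul_cons_removeNth {n : ℕ} (F : L [⋀^Fin (n + 1)]→ₗ[k] M) (y : L)
    (g : Fin (n + 1) → L) (l : Fin (n + 1)) :
    ((-1 : k) ^ (l : ℕ)) • F (Fin.cons y fun m => g (l.succAbove m)) =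
      F (Function.update g l y) := by
  have h := F.map_insertNth l y (l.removeNth g)
  rw [Fin.insertNth_removeNth] at h
  rw [h, neg_one_pow_smul_eq]
  rfl

theorem map_cons_cons_swap {n : ℕ} (F : L [⋀^Fin (n + 2)]→ₗ[k] M) (x y : L) (g : Fin n → L) :
    F (Fin.cons x (Fin.cons y g : Fin (n + 1) → L)) =
      - F (Fin.cons y (Fin.cons x g : Fin (n + 1) → L)) :=
  DFunLike.congr_fun (contr_anticomm y x F) g

variable [LieRingModule L M] [LieModule k L M]

/-- The Lie derivative `L_x` of cochains. -/
def lieDer {n : ℕ} (x : L) : (L [⋀^Fin n]→ₗ[k] M) →ₗ[k] (L [⋀^Fin n]→ₗ[k] M) where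
  toFun F := (LieModule.toEnd k L M x).compAlternatingMap F - derivForm (LieAlgebra.ad k L x) F
  map_add' F G := by
    ext g
    simp [derivForm_apply, Finset.sum_add_distrib]
    abel
  map_smul' c F := by
    ext g
    simp [derivForm_apply, Finset.smul_sum, smul_sub]

theorem lieDer_apply {n : ℕ} (x : L) (F : L [⋀^Fin n]→ₗ[k] M) (g : Fin n → L) :
    lieDer x F g = ⁅x, F g⁆ - ∑ l : Fin n, F (Function.update g l ⁅x, g l⁆) := by
  simp [lieDer, derivForm_apply]

theorem contr_lieDer {n : ℕ} (x y : L) (F : L [⋀^Fin (n + 1)]→ₗ[k] M) :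
    contr y (lieDer x F) = lieDer x (contr y F) - contr ⁅x, y⁆ F := by
  ext g
  simp only [contr_apply, lieDer_apply, Fin.sum_univ_succ, Fin.cons_zero, Fin.cons_succ,
    Fin.update_cons_zero, ← Fin.cons_update, AlternatingMap.sub_apply]
  abel

theorem lieDer_lieDer {n : ℕ} (x y : L) (F : L [⋀^Fin n]→ₗ[k] M) :
    lieDer x (lieDer y F) = lieDer y (lieDer x F) + lieDer ⁅x, y⁆ F := by
  induction n with
  | zero =>
    ext g
    simp [lieDer_apply]
  | succ n ih =>
    refine ext_contr fun z => ?_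
    simp only [contr_lieDer, map_add, map_sub, ih]
    rw [lie_lie x y z]
    have : contr (⁅x, ⁅y, z⁆⁆ - ⁅y, ⁅x, z⁆⁆) F = contr ⁅x, ⁅y, z⁆⁆ F - contr ⁅y, ⁅x, z⁆⁆ F :=
      F.curryLeft.map_sub _ _
    rw [this]
    abel

theorem ceDelta_zero_cons (F : L [⋀^Fin 0]→ₗ[k] M) (x : L) (g : Fin 0 → L) :
    ceDelta k L M 0 F (Fin.cons x g) = lieDer x F g := by
  simp only [ceDelta, ceBracketTerm, lieDer_apply, LinearMap.coe_mk, AddHom.coe_mk]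
  simp

/-- Cartan's formula, read as a recursion for the coboundary. The terms of the explicit sum in which
`x` acts or is bracketed make up the Lie derivative; in all others `x` is a mere argument of `F`. -/
theorem ceDelta_succ_cons {n : ℕ} (F : L [⋀^Fin (n + 1)]→ₗ[k] M) (x : L) (g : Fin (n + 1) → L) :
    ceDelta k L M (n + 1) F (Fin.cons x g) =
      lieDer x F g - ceDelta k L M n (contr x F) g := by
  have hB : ceBracketTerm k L M F (Fin.cons x g : Fin (n + 2) → L) =
      - (∑ l : Fin (n + 1), F (Function.update g l ⁅x, g l⁆))
        - ceBracketTerm k L M (contr x F) g := by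
    simp only [ceBracketTerm]
    rw [Fin.sum_univ_succ]
    have h0 : ∀ l : Fin (n + 1),
        (-1 : k) ^ (((0 : Fin (n + 1)) : ℕ) + ((l.succ : Fin (n + 2)) : ℕ)) •
        F (Fin.cons ⁅(Fin.cons x g : Fin (n + 2) → L) (0 : Fin (n + 1)).castSucc,
          (Fin.cons x g : Fin (n + 2) → L) l.succ⁆
          fun m => (Fin.cons x g : Fin (n + 2) → L) (l.succ.succAbove ((0 : Fin (n + 1)).succAbove m)))
        = - F (Function.update g l ⁅x, g l⁆) := by
      intro l
      rw [← neg_one_pow_smul_cons_removeNth]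
      simp [pow_succ]
    have hz : (∑ i : Fin (n + 1), if i.castSucc < (0 : Fin (n + 2)) then
        (-1 : k) ^ ((i : ℕ) + ((0 : Fin (n + 2)) : ℕ)) •
        F (Fin.cons ⁅(Fin.cons x g : Fin (n + 2) → L) i.castSucc,
          (Fin.cons x g : Fin (n + 2) → L) 0⁆
          fun m => (Fin.cons x g : Fin (n + 2) → L) ((0 : Fin (n + 2)).succAbove (i.succAbove m)))
        else 0) = 0 :=
      Finset.sum_eq_zero fun i _ => if_neg (Fin.not_lt_zero _)
    rw [hz, zero_add]
    cases n with
    | zero => simpa [ceBracketTerm] using h0 0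
    | succ n =>
      -- For brackets not involving `x`, bringing `x` in front of the bracket costs one
      -- transposition, whence the sign.
      have h1 : ∀ l : Fin (n + 2), ∀ i : Fin (n + 1),
          (if i.succ.castSucc < l.succ then
            (-1 : k) ^ ((i.succ : ℕ) + (l.succ : ℕ)) •
            F (Fin.cons ⁅(Fin.cons x g : Fin (n + 3) → L) i.succ.castSucc,
              (Fin.cons x g : Fin (n + 3) → L) l.succ⁆
              fun m => (Fin.cons x g : Fin (n + 3) → L) (l.succ.succAbove (i.succ.succAbove m)))
            else 0) = -(if i.castSucc < l then
            (-1 : k) ^ ((i : ℕ) + (l : ℕ)) •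
            contr x F (Fin.cons ⁅g i.castSucc, g l⁆ fun m => g (l.succAbove (i.succAbove m)))
            else 0) := by
        intro l i
        have hlt : i.succ.castSucc < l.succ ↔ i.castSucc < l := by
          simp [Fin.lt_def]
        by_cases h : i.castSucc < l
        · rw [if_pos (hlt.2 h), if_pos h, contr_apply, map_cons_cons_swap, smul_neg, neg_neg]
          have e1 : (-1 : k) ^ ((i.succ : ℕ) + (l.succ : ℕ)) = (-1) ^ ((i : ℕ) + (l : ℕ)) := by
            simp only [Fin.val_succ, pow_add, pow_one]
            ring
          rw [e1, ← Fin.succ_castSucc, Fin.cons_succ, Fin.cons_succ]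
          congr 3
          funext m
          cases m using Fin.cases with
          | zero => simp
          | succ m => simp [Fin.succ_succAbove_succ]
        · rw [if_neg (fun h' => h (hlt.1 h')), if_neg h, neg_zero]
      simp only
      rw [← Finset.sum_neg_distrib, sub_eq_add_neg, ← Finset.sum_neg_distrib,
        ← Finset.sum_add_distrib]
      refine Finset.sum_congr rfl fun l _ => ?_
      rw [Fin.sum_univ_succ, if_pos (by simp [Fin.lt_def]), h0 l, ← Finset.sum_neg_distrib]
      exact congrArg _ (Finset.sum_congr rfl fun i _ => h1 l i)
  rw [ceDelta]
  simp only [LinearMap.coe_mk, AddHom.coe_mk]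
  rw [hB, Fin.sum_univ_succ, lieDer_apply]
  simp only [ceDelta, LinearMap.coe_mk, AddHom.coe_mk]
  have h1 : ∀ i : Fin (n + 1), (-1 : k) ^ ((i.succ : Fin (n + 2)) : ℕ) •
      ⁅(Fin.cons x g : Fin (n + 2) → L) i.succ,
        F fun l => (Fin.cons x g : Fin (n + 2) → L) (i.succ.succAbove l)⁆ =
      - ((-1 : k) ^ (i : ℕ) • ⁅g i, contr x F fun l => g (i.succAbove l)⁆) := by
    intro i
    simp only [Fin.val_succ, pow_succ, Fin.cons_succ, contr_apply]
    rw [mul_neg, mul_one, neg_smul]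
    congr 5
    funext l
    cases l using Fin.cases with
    | zero => simp
    | succ l => simp [Fin.succ_succAbove_succ]
  simp only [h1, Finset.sum_neg_distrib]
  simp
  abel

end CartanCalculus

end LiePoset

namespace LiePoset

/-! ### The coboundary as a linear map between forms, and exterior multiplication -/

section Coboundary

variable {k L M : Type*} [CommRing k] [LieRing L] [LieAlgebra k L]
  [AddCommGroup M] [Module k M]

/-- Exterior multiplication by a linear form. -/
def wedge {n : ℕ} (ξ : L →ₗ[k] k) : (L [⋀^Fin n]→ₗ[k] M) →ₗ[k] (L [⋀^Fin (n + 1)]→ₗ[k] M) where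
  toFun F := AlternatingMap.alternatizeUncurryFin (ξ.smulRight F)
  map_add' F G := by
    ext g
    simp [AlternatingMap.alternatizeUncurryFin_apply, Finset.sum_add_distrib]
  map_smul' c F := by
    ext g
    simp only [AlternatingMap.alternatizeUncurryFin_apply, LinearMap.smulRight_apply,
      AlternatingMap.smul_apply, RingHom.id_apply, Finset.smul_sum]
    exact Finset.sum_congr rfl fun i _ => by rw [smul_comm c, smul_comm c]

theorem contr_wedge_zero (ξ : L →ₗ[k] k) (x : L) (F : L [⋀^Fin 0]→ₗ[k] M) :
    contr x (wedge ξ F) = ξ x • F := by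
  ext g
  simp [wedge, AlternatingMap.alternatizeUncurryFin_apply]

theorem contr_wedge_succ {n : ℕ} (ξ : L →ₗ[k] k) (x : L) (F : L [⋀^Fin (n + 1)]→ₗ[k] M) :
    contr x (wedge ξ F) = ξ x • F - wedge ξ (contr x F) := by
  ext g
  simp only [wedge, contr_apply, LinearMap.coe_mk, AddHom.coe_mk, AlternatingMap.sub_apply,
    AlternatingMap.alternatizeUncurryFin_apply, LinearMap.smulRight_apply,
    AlternatingMap.smul_apply]
  rw [Fin.sum_univ_succ, sub_eq_add_neg, ← Finset.sum_neg_distrib]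
  congr 1
  · simp
  · refine Finset.sum_congr rfl fun i _ => ?_
    have : (i.succ.removeNth (Fin.cons x g : Fin (n + 2) → L) : Fin (n + 1) → L) =
        Fin.cons x (i.removeNth g) := by
      funext l
      cases l using Fin.cases with
      | zero => simp [Fin.removeNth]
      | succ l => simp [Fin.removeNth, Fin.succ_succAbove_succ]
    rw [this]
    simp [pow_succ]

variable [LieRingModule L M] [LieModule k L M]

theorem lieDer_add_left {n : ℕ} (x y : L) (F : L [⋀^Fin n]→ₗ[k] M) :
    lieDer (x + y) F = lieDer x F + lieDer y F := by
  ext g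
  simp [lieDer_apply, Finset.sum_add_distrib]
  abel

theorem lieDer_smul_left {n : ℕ} (c : k) (x : L) (F : L [⋀^Fin n]→ₗ[k] M) :
    lieDer (c • x) F = c • lieDer x F := by
  ext g
  simp [lieDer_apply, Finset.smul_sum, smul_sub]

/-- Uncurrying of a linear map into forms to a form, provided it is alternating in its first two
arguments. -/
def uncurryForm {n : ℕ} (A : L →ₗ[k] (L [⋀^Fin n]→ₗ[k] M))
    (hA : ∀ (x : L) (g : Fin n → L), (∃ j, g j = x) → A x g = 0) : L [⋀^Fin (n + 1)]→ₗ[k] M where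
  toMultilinearMap := LinearMap.uncurryLeft (AlternatingMap.toMultilinearMapLM (S := k) ∘ₗ A)
  map_eq_zero_of_eq' := by
    intro v i j hv hij
    change A (v 0) (Fin.tail v) = 0
    cases i using Fin.cases with
    | zero =>
      cases j using Fin.cases with
      | zero => exact absurd rfl hij
      | succ j => exact hA _ _ ⟨j, hv.symm⟩
    | succ i =>
      cases j using Fin.cases with
      | zero => exact hA _ _ ⟨i, hv⟩
      | succ j => exact (A (v 0)).map_eq_zero_of_eq _ hv fun h => hij (congrArg _ h)

/-- `ceDelta` yields a bare function of the arguments. That it is alternating follows by induction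
from the Cartan recursion, with no manipulation of the double sum. -/
theorem exists_form_eq_ceDelta (n : ℕ) (F : L [⋀^Fin n]→ₗ[k] M) :
    ∃ G : L [⋀^Fin (n + 1)]→ₗ[k] M, ∀ g, G g = ceDelta k L M n F g := by
  induction n with
  | zero =>
    refine ⟨uncurryForm
      { toFun := fun x => lieDer x F
        map_add' := fun x y => lieDer_add_left x y F
        map_smul' := fun c x => lieDer_smul_left c x F } fun x g ⟨j, _⟩ => j.elim0, fun g => ?_⟩
    rw [← Fin.cons_self_tail g, ceDelta_zero_cons]
    rfl
  | succ n ih =>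
    choose D hD using ih
    have hc : ∀ x g, (lieDer x F - D (contr x F)) g = ceDelta k L M (n + 1) F (Fin.cons x g) := by
      intro x g
      rw [ceDelta_succ_cons, AlternatingMap.sub_apply, hD]
    let A : L →ₗ[k] (L [⋀^Fin (n + 1)]→ₗ[k] M) :=
      { toFun := fun x => lieDer x F - D (contr x F)
        map_add' := fun x y => by
          ext g
          simp [hD, lieDer_add_left, contr_add_left]
          abel
        map_smul' := fun c x => by
          ext g
          simp [hD, lieDer_smul_left, contr_smul_left, smul_sub] }
    -- For a repeated leading argument, both terms equal $L_x\iota_xF$, because $[x,x]=0$ and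
    -- $\iota_x\iota_x=0$.
    have h0 : ∀ (x : L) (g : Fin n → L), A x (Fin.cons x g) = 0 := by
      intro x g
      change lieDer x F (Fin.cons x g) - D (contr x F) (Fin.cons x g) = 0
      have h1 : lieDer x F (Fin.cons x g) = lieDer x (contr x F) g := by
        rw [← contr_apply, contr_lieDer, lie_self]
        have : contr (0 : L) F = 0 := F.curryLeft.map_zero
        rw [this, sub_zero]
      rw [h1, hD]
      cases n with
      | zero => rw [ceDelta_zero_cons, sub_self]
      | succ n => rw [ceDelta_succ_cons, contr_contr_self, map_zero]; simp
    refine ⟨uncurryForm A fun x g ⟨j, hj⟩ => ?_, fun g => ?_⟩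
    -- A repetition in slot `j` is moved to slot `0`, which only changes the sign.
    · have h2 := (A x).map_perm g (Equiv.swap 0 j)
      have h3 : g ∘ (Equiv.swap 0 j) = Fin.cons x (Fin.tail (g ∘ (Equiv.swap 0 j))) := by
        rw [← hj]
        conv_lhs => rw [← Fin.cons_self_tail (g ∘ (Equiv.swap 0 j))]
        simp
      rw [h3, h0] at h2
      exact (smul_eq_zero_iff_eq _).1 h2.symm
    · rw [← Fin.cons_self_tail g, ← hc]
      rfl

/-- The Chevalley–Eilenberg coboundary as a linear map between spaces of alternating maps. -/
noncomputable def ceD {n : ℕ} : (L [⋀^Fin n]→ₗ[k] M) →ₗ[k] (L [⋀^Fin (n + 1)]→ₗ[k] M) where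
  toFun F := (exists_form_eq_ceDelta n F).choose
  map_add' F G := by
    ext g
    rw [(exists_form_eq_ceDelta n (F + G)).choose_spec]
    simp [(exists_form_eq_ceDelta n _).choose_spec]
  map_smul' c F := by
    ext g
    rw [(exists_form_eq_ceDelta n (c • F)).choose_spec]
    simp [(exists_form_eq_ceDelta n _).choose_spec]

theorem ceD_apply {n : ℕ} (F : L [⋀^Fin n]→ₗ[k] M) (g : Fin (n + 1) → L) :
    ceD F g = ceDelta k L M n F g :=
  (exists_form_eq_ceDelta n F).choose_spec g

theorem contr_ceD_zero (x : L) (F : L [⋀^Fin 0]→ₗ[k] M) : contr x (ceD F) = lieDer x F := by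
  ext g
  rw [contr_apply, ceD_apply, ceDelta_zero_cons]

/-- Cartan's formula `ι_x d + d ι_x = L_x`. -/
theorem contr_ceD_succ {n : ℕ} (x : L) (F : L [⋀^Fin (n + 1)]→ₗ[k] M) :
    contr x (ceD F) = lieDer x F - ceD (contr x F) := by
  ext g
  rw [contr_apply, ceD_apply, ceDelta_succ_cons, AlternatingMap.sub_apply, ceD_apply]

theorem ceD_lieDer {n : ℕ} (x : L) (F : L [⋀^Fin n]→ₗ[k] M) :
    ceD (lieDer x F) = lieDer x (ceD F) := by
  induction n with
  | zero =>
    refine ext_contr fun y => ?_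
    rw [contr_lieDer, contr_ceD_zero, contr_ceD_zero, contr_ceD_zero, lieDer_lieDer x y]
    abel
  | succ n ih =>
    refine ext_contr fun y => ?_
    rw [contr_lieDer, contr_ceD_succ, contr_ceD_succ, contr_ceD_succ, contr_lieDer, map_sub,
      map_sub, ih, lieDer_lieDer x y]
    abel

theorem ceD_ceD {n : ℕ} (F : L [⋀^Fin n]→ₗ[k] M) : ceD (ceD F) = 0 := by
  induction n with
  | zero =>
    refine ext_contr fun y => ?_
    rw [contr_ceD_succ, contr_ceD_zero, ceD_lieDer, sub_self, map_zero]
  | succ n ih =>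
    refine ext_contr fun y => ?_
    rw [contr_ceD_succ, contr_ceD_succ, map_sub, ih, ceD_lieDer, sub_zero, sub_self, map_zero]

theorem ceD_eq_zero_iff {n : ℕ} {F : L [⋀^Fin n]→ₗ[k] M} :
    ceD F = 0 ↔ F ∈ ceCocycles k L M n := by
  rw [ceCocycles, LinearMap.mem_ker, funext_iff, AlternatingMap.ext_iff]
  simp only [ceD_apply, AlternatingMap.zero_apply, Pi.zero_apply]

theorem ceCocycles_eq (n : ℕ) : ceCocycles k L M n = LinearMap.ker ceD := by
  ext F
  rw [LinearMap.mem_ker, ceD_eq_zero_iff]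

theorem ceCoboundaries_succ (n : ℕ) :
    ceCoboundaries k L M (n + 1) = LinearMap.range (ceD (k := k) (L := L) (M := M) (n := n)) := by
  ext F
  change (∃ G : L [⋀^Fin n]→ₗ[k] M, ∀ g : Fin (n + 1) → L, F g = ceDelta k L M n G g) ↔ _
  simp only [← ceD_apply, LinearMap.mem_range, ← AlternatingMap.ext_iff, eq_comm]

theorem lieDer_wedge {n : ℕ} (ξ : L →ₗ[k] k) (hξ : ∀ x y : L, ξ ⁅x, y⁆ = 0) (x : L)
    (F : L [⋀^Fin n]→ₗ[k] M) : lieDer x (wedge ξ F) = wedge ξ (lieDer x F) := by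
  induction n with
  | zero =>
    refine ext_contr fun y => ?_
    rw [contr_lieDer, contr_wedge_zero, contr_wedge_zero, contr_wedge_zero, hξ]
    simp
  | succ n ih =>
    refine ext_contr fun y => ?_
    rw [contr_lieDer, contr_wedge_succ, contr_wedge_succ, contr_wedge_succ, contr_lieDer, hξ,
      map_sub, map_sub, ih, map_smul]
    simp only [zero_smul, zero_sub]
    abel

/-- A form vanishing on brackets is a closed 1-cochain, so only the sign of the Leibniz rule is
left. -/
theorem ceD_wedge {n : ℕ} (ξ : L →ₗ[k] k) (hξ : ∀ x y : L, ξ ⁅x, y⁆ = 0)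
    (F : L [⋀^Fin n]→ₗ[k] M) : ceD (wedge ξ F) = - wedge ξ (ceD F) := by
  induction n with
  | zero =>
    refine ext_contr fun y => ?_
    rw [map_neg, contr_wedge_succ, contr_ceD_succ, contr_ceD_zero, contr_wedge_zero,
      lieDer_wedge ξ hξ, map_smul]
    abel
  | succ n ih =>
    refine ext_contr fun y => ?_
    rw [map_neg, contr_wedge_succ, contr_ceD_succ, contr_ceD_succ, contr_wedge_succ,
      lieDer_wedge ξ hξ, map_sub, map_sub, ih, map_smul]
    abel

end Coboundary

end LiePoset

namespace LiePoset

/-! ### Dimension counts for subcomplexes -/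

section Dimensions

open Module

theorem finrank_map_add_finrank_inf_ker {k V W : Type*} [Field k] [AddCommGroup V] [Module k V]
    [FiniteDimensional k V] [AddCommGroup W] [Module k W] (f : V →ₗ[k] W) (K : Submodule k V) :
    finrank k (K.map f) + finrank k (K ⊓ LinearMap.ker f : Submodule k V) = finrank k K := by
  rw [← LinearMap.finrank_range_add_finrank_ker (f.domRestrict K), LinearMap.range_domRestrict]
  congr 1
  rw [LinearMap.ker_domRestrict]
  have := (Submodule.comapSubtypeEquivOfLe (p := K ⊓ LinearMap.ker f) (q := K) inf_le_left)
  rw [← this.finrank_eq, Submodule.comap_inf, Submodule.comap_subtype_self, top_inf_eq]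

theorem finrank_map_of_injOn {k V W : Type*} [Field k] [AddCommGroup V] [Module k V]
    [AddCommGroup W] [Module k W] (f : V →ₗ[k] W) (K : Submodule k V)
    (h : ∀ v ∈ K, f v = 0 → v = 0) : finrank k (K.map f) = finrank k K := by
  rw [← LinearMap.range_domRestrict]
  refine LinearMap.finrank_range_of_inj ?_
  rw [← LinearMap.ker_eq_bot, LinearMap.ker_eq_bot']
  exact fun v hv => Subtype.ext (h v.1 v.2 hv)

theorem finrank_quotient_submoduleOf {k V : Type*} [Field k] [AddCommGroup V] [Module k V]
    [FiniteDimensional k V] {B Z : Submodule k V} (h : B ≤ Z) :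
    (finrank k (Z ⧸ B.submoduleOf Z) : ℤ) = finrank k Z - finrank k B := by
  have h1 := Submodule.finrank_quotient_add_finrank (B.submoduleOf Z)
  rw [(Submodule.submoduleOfEquivOfLe h).finrank_eq] at h1
  omega

variable {k L M : Type*} [Field k] [LieRing L] [LieAlgebra k L]
  [AddCommGroup M] [Module k M]

/-- The cochains that vanish as soon as one argument is `x`. -/
def kerContr (x : L) : ∀ n : ℕ, Submodule k (L [⋀^Fin n]→ₗ[k] M)
  | 0 => ⊤
  | _ + 1 => LinearMap.ker (contr x)

theorem mem_kerContr_succ {x : L} {n : ℕ} {F : L [⋀^Fin (n + 1)]→ₗ[k] M} :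
    F ∈ kerContr x (n + 1) ↔ contr x F = 0 := Iff.rfl

theorem contr_wedge_of_mem_kerContr {n : ℕ} {ξ : L →ₗ[k] k} {x : L} (hξ : ξ x = 1)
    {F : L [⋀^Fin n]→ₗ[k] M} (hF : F ∈ kerContr x n) : contr x (wedge ξ F) = F := by
  cases n with
  | zero => rw [contr_wedge_zero, hξ, one_smul]
  | succ n => rw [contr_wedge_succ, mem_kerContr_succ.1 hF, map_zero, hξ, one_smul, sub_zero]

theorem contr_mem_kerContr {n : ℕ} (x : L) (F : L [⋀^Fin (n + 1)]→ₗ[k] M) :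
    contr x F ∈ kerContr x n := by
  cases n with
  | zero => trivial
  | succ n => exact contr_contr_self x F

instance finiteDimensional_form [FiniteDimensional k L] [FiniteDimensional k M] (n : ℕ) :
    FiniteDimensional k (L [⋀^Fin n]→ₗ[k] M) :=
  Module.Finite.equiv exteriorPower.alternatingMapLinearEquiv.symm

variable [FiniteDimensional k L] [FiniteDimensional k M]

/-- Contraction with `x` kills `A` and inverts `wedge ξ` on `B`; hence the sum is direct and `wedge
ξ` is injective on `B`. -/
theorem finrank_sup_map_wedge {n : ℕ} {ξ : L →ₗ[k] k} {x : L} (hξ : ξ x = 1)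
    {A : Submodule k (L [⋀^Fin (n + 1)]→ₗ[k] M)} {B : Submodule k (L [⋀^Fin n]→ₗ[k] M)}
    (hA : A ≤ kerContr x (n + 1)) (hB : B ≤ kerContr x n) :
    finrank k (A ⊔ B.map (wedge ξ) : Submodule k (L [⋀^Fin (n + 1)]→ₗ[k] M)) =
      finrank k A + finrank k B := by
  have h := Submodule.finrank_sup_add_finrank_inf_eq A (B.map (wedge ξ))
  have h0 : A ⊓ B.map (wedge ξ) = ⊥ := by
    rw [eq_bot_iff]
    rintro _ ⟨hF, G, hG, rfl⟩
    have h1 := mem_kerContr_succ.1 (hA hF)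
    rw [contr_wedge_of_mem_kerContr hξ (hB hG)] at h1
    rw [h1, map_zero]
    exact zero_mem _
  rw [h0, finrank_bot, add_zero, finrank_map_of_injOn] at h
  · exact h
  · intro F hF h1
    rw [← contr_wedge_of_mem_kerContr hξ (hB hF), h1, map_zero]

variable [LieRingModule L M] [LieModule k L M]

/-- The dimension of the cohomology of the subcomplex `K` of the Chevalley–Eilenberg complex,
expressed through the dimensions of the spaces of cochains and the ranks of the coboundaries. -/
noncomputable def cohomDim (K : ∀ n, Submodule k (L [⋀^Fin n]→ₗ[k] M)) : ℕ → ℤ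
  | 0 => finrank k (K 0) - finrank k ((K 0).map ceD)
  | n + 1 => finrank k (K (n + 1)) - finrank k ((K (n + 1)).map ceD) - finrank k ((K n).map ceD)

theorem cohomDim_zero (K : ∀ n, Submodule k (L [⋀^Fin n]→ₗ[k] M)) :
    cohomDim K 0 = finrank k (K 0 ⊓ LinearMap.ker ceD : Submodule k _) := by
  rw [cohomDim, ← finrank_map_add_finrank_inf_ker ceD (K 0)]
  push_cast
  ring

theorem cohomDim_succ (K : ∀ n, Submodule k (L [⋀^Fin n]→ₗ[k] M)) (n : ℕ) :
    cohomDim K (n + 1) = finrank k (K (n + 1) ⊓ LinearMap.ker ceD : Submodule k _) -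
      finrank k ((K n).map ceD) := by
  rw [cohomDim, ← finrank_map_add_finrank_inf_ker ceD (K (n + 1))]
  push_cast
  ring

theorem finrank_ceCohomology (n : ℕ) :
    (finrank k (ceCohomology k L M n) : ℤ) = cohomDim (k := k) (L := L) (M := M) (fun _ => ⊤) n := by
  cases n with
  | zero =>
    have hb : ceCoboundaries k L M 0 = ⊥ := rfl
    rw [cohomDim_zero, finrank_quotient_submoduleOf (hb ▸ bot_le), hb, ceCocycles_eq, top_inf_eq]
    simp
  | succ n =>
    rw [cohomDim_succ, finrank_quotient_submoduleOf, ceCocycles_eq,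
      ceCoboundaries_succ, top_inf_eq, Submodule.map_top]
    rw [ceCocycles_eq, ceCoboundaries_succ]
    rintro _ ⟨G, rfl⟩
    exact ceD_ceD G

/-- The generating function of the dimensions of the cohomology of a subcomplex. -/
noncomputable def cohomSeries (K : ∀ n, Submodule k (L [⋀^Fin n]→ₗ[k] M)) : PowerSeries ℤ :=
  PowerSeries.mk (cohomDim K)

/-- If `x` acts trivially on the subcomplex `K` and contraction with `x` and exterior
multiplication with an invariant form `ξ` with `ξ x = 1` preserve it, then `K` is the direct sum of
its part killed by `x` and a shifted copy of the latter. -/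
theorem cohomSeries_eq_mul (K : ∀ n, Submodule k (L [⋀^Fin n]→ₗ[k] M)) {ξ : L →ₗ[k] k} {x : L}
    (hξ : ξ x = 1) (hξ' : ∀ y z : L, ξ ⁅y, z⁆ = 0)
    (hL : ∀ n, ∀ F ∈ K n, lieDer x F = 0) (hc : ∀ n, ∀ F ∈ K (n + 1), contr x F ∈ K n)
    (hw : ∀ n, ∀ F ∈ K n, wedge ξ F ∈ K (n + 1)) :
    cohomSeries K = (1 + PowerSeries.X) * cohomSeries (fun m => K m ⊓ kerContr x m) := by
  set K' : ∀ m, Submodule k (L [⋀^Fin m]→ₗ[k] M) := fun m => K m ⊓ kerContr x m with hK'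
  -- The splitting is $F=(F-\xi\wedge\iota_xF)+\xi\wedge\iota_xF$.
  have hK : ∀ n, K (n + 1) = K' (n + 1) ⊔ (K' n).map (wedge ξ) := by
    intro n
    refine le_antisymm ?_ (sup_le inf_le_left ?_)
    · intro F hF
      have h1 : contr x F ∈ K' n := ⟨hc n F hF, contr_mem_kerContr x F⟩
      have h2 : F = (F - wedge ξ (contr x F)) + wedge ξ (contr x F) := by abel
      rw [h2]
      refine Submodule.add_mem_sup ⟨sub_mem hF (hw _ _ (hc _ _ hF)), ?_⟩ ⟨_, h1, rfl⟩
      change contr x _ = 0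
      rw [map_sub, contr_wedge_of_mem_kerContr hξ h1.2, sub_self]
    · rintro _ ⟨F, hF, rfl⟩
      exact hw _ _ hF.1
  have hK0 : K 0 = K' 0 := by simp [hK', kerContr]
  -- By Cartan's formula with $L_x=0$, so the splitting applies to the images of the coboundary as
  -- well.
  have hd : ∀ n, (K' n).map ceD ≤ kerContr x (n + 1) := by
    rintro n _ ⟨F, hF, rfl⟩
    change contr x _ = 0
    cases n with
    | zero => rw [contr_ceD_zero, hL _ _ hF.1]
    | succ n => rw [contr_ceD_succ, hL _ _ hF.1, mem_kerContr_succ.1 hF.2, map_zero, sub_zero]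
  have hD : ∀ n, finrank k (K (n + 1)) = finrank k (K' (n + 1)) + finrank k (K' n) := by
    intro n
    rw [hK, finrank_sup_map_wedge hξ inf_le_right inf_le_right]
  have hR : ∀ n, finrank k ((K (n + 1)).map ceD) =
      finrank k ((K' (n + 1)).map ceD) + finrank k ((K' n).map ceD) := by
    intro n
    have h1 : ((K' n).map (wedge ξ)).map ceD = ((K' n).map ceD).map (wedge ξ) := by
      rw [← Submodule.map_comp, ← Submodule.map_comp, ← Submodule.map_neg]
      congr 1
      ext1 F
      simp [ceD_wedge ξ hξ']
    rw [hK, Submodule.map_sup, h1, finrank_sup_map_wedge hξ (hd _) (hd _)]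
  ext n
  rw [add_mul, one_mul, map_add]
  cases n with
  | zero =>
    rw [PowerSeries.coeff_zero_X_mul, add_zero]
    simp only [cohomSeries, PowerSeries.coeff_mk]
    rw [cohomDim, cohomDim, hK0]
  | succ n =>
    rw [PowerSeries.coeff_succ_X_mul]
    simp only [cohomSeries, PowerSeries.coeff_mk]
    cases n with
    | zero => rw [cohomDim, cohomDim, cohomDim, hD, hR, hK0]; push_cast; ring
    | succ n => simp only [cohomDim, hD, hR]; push_cast; ring

theorem aeval_mem {V : Type*} [AddCommGroup V] [Module k V] (A : Module.End k V)
    (K : Submodule k V) (hA : ∀ v ∈ K, A v ∈ K) (q : Polynomial k) {v : V} (hv : v ∈ K) :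
    Polynomial.aeval A q v ∈ K := by
  have hpow : ∀ n : ℕ, (A ^ n) v ∈ K := by
    intro n
    induction n with
    | zero => simpa
    | succ n ih => rw [pow_succ']; exact hA _ ih
  rw [Polynomial.aeval_eq_sum_range, LinearMap.sum_apply]
  exact Submodule.sum_mem _ fun i _ => K.smul_mem _ (hpow i)

theorem map_aeval {V W : Type*} [AddCommGroup V] [Module k V] [AddCommGroup W] [Module k W]
    (A : Module.End k V) (B : Module.End k W) (d : V →ₗ[k] W) (hd : ∀ v, d (A v) = B (d v))
    (q : Polynomial k) (v : V) : d (Polynomial.aeval A q v) = Polynomial.aeval B q (d v) := by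
  have hpow : ∀ n : ℕ, d ((A ^ n) v) = (B ^ n) (d v) := by
    intro n
    induction n with
    | zero => simp
    | succ n ih => rw [pow_succ', pow_succ', Module.End.mul_apply, Module.End.mul_apply, hd, ih]
  rw [Polynomial.aeval_eq_sum_range, Polynomial.aeval_eq_sum_range]
  simp [LinearMap.sum_apply, hpow]

/-- A subcomplex on which `x` acts semisimply (in the sense that `A (1 - A q(A)) = 0` for some
polynomial `q`, where `A` is the action of `x`) has the same cohomology as its part killed by the
action of `x`. -/
theorem cohomDim_inf_ker_lieDer (K : ∀ n, Submodule k (L [⋀^Fin n]→ₗ[k] M)) (x : L)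
    (hL : ∀ n, ∀ F ∈ K n, lieDer x F ∈ K n) (hc : ∀ n, ∀ F ∈ K (n + 1), contr x F ∈ K n)
    (hd : ∀ n, ∀ F ∈ K n, ceD F ∈ K (n + 1))
    (hq : ∀ n, ∃ q : Polynomial k, ∀ m ≤ n, ∀ F : L [⋀^Fin m]→ₗ[k] M,
      lieDer x (F - lieDer x (Polynomial.aeval (lieDer x) q F)) = 0) (n : ℕ) :
    cohomDim K n = cohomDim (fun m => K m ⊓ LinearMap.ker (lieDer x)) n := by
  cases n with
  | zero =>
    rw [cohomDim_zero, cohomDim_zero]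
    have h : K 0 ⊓ LinearMap.ker ceD = (K 0 ⊓ LinearMap.ker (lieDer x)) ⊓ LinearMap.ker ceD := by
      refine le_antisymm (fun F hF => ⟨⟨hF.1, ?_⟩, hF.2⟩) (fun F hF => ⟨hF.1.1, hF.2⟩)
      change lieDer x F = 0
      rw [← contr_ceD_zero, LinearMap.mem_ker.1 hF.2, map_zero]
    rw [h]
  | succ n =>
    obtain ⟨q, hq⟩ := hq (n + 1)
    rw [cohomDim_succ, cohomDim_succ]
    set Z := K (n + 1) ⊓ LinearMap.ker ceD with hZ
    set Z' := (K (n + 1) ⊓ LinearMap.ker (lieDer x)) ⊓ LinearMap.ker ceD with hZ'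
    set B := (K n).map ceD with hB
    set B' := (K n ⊓ LinearMap.ker (lieDer x)).map ceD with hB'
    have h1 : Z = Z' ⊔ B := by
      refine le_antisymm ?_ (sup_le (fun F hF => ⟨hF.1.1, hF.2⟩) ?_)
      · rintro F ⟨hF, hF'⟩
        -- With $A=L_x$, the operator $1-Aq(A)$ maps into $\ker A$. For closed $F$ the remainder
        -- $Aq(A)F$ is exact, by Cartan's formula applied to the closed cochain $q(A)F$.
        have e : lieDer x (Polynomial.aeval (lieDer x) q F) =
            ceD (contr x (Polynomial.aeval (lieDer x) q F)) := by
          have e1 := contr_ceD_succ x (Polynomial.aeval (lieDer x) q F)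
          rw [map_aeval _ (lieDer x) ceD (ceD_lieDer x), LinearMap.mem_ker.1 hF', map_zero,
            map_zero] at e1
          exact sub_eq_zero.1 e1.symm
        have h3 : Polynomial.aeval (lieDer x) q F ∈ K (n + 1) := aeval_mem _ _ (hL _) q hF
        rw [← sub_add_cancel F (lieDer x (Polynomial.aeval (lieDer x) q F))]
        refine Submodule.add_mem_sup ⟨⟨sub_mem hF (hL _ _ h3), hq _ le_rfl F⟩, ?_⟩ ?_
        · change ceD _ = 0
          rw [map_sub, e, ceD_ceD, LinearMap.mem_ker.1 hF', sub_zero]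
        · rw [e]
          exact ⟨_, hc _ _ h3, rfl⟩
      · rintro _ ⟨F, hF, rfl⟩
        exact ⟨hd _ _ hF, ceD_ceD F⟩
    have h2 : Z' ⊓ B = B' := by
      refine le_antisymm ?_ ?_
      · rintro _ ⟨hF, G, hG, rfl⟩
        have h3 : Polynomial.aeval (lieDer x) q G ∈ K n := aeval_mem _ _ (hL _) q hG
        -- If $dG$ is killed by $A$, then $G$ may be replaced by $G-Aq(A)G$, which is invariant and
        -- has the same coboundary, since $Aq(A)\,dG=q(A)A\,dG=0$.
        refine ⟨G - lieDer x (Polynomial.aeval (lieDer x) q G),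
          ⟨sub_mem hG (hL _ _ h3), hq _ (Nat.le_succ n) G⟩, ?_⟩
        have e : lieDer x (ceD G) = 0 := hF.1.2
        rw [map_sub, ceD_lieDer, map_aeval _ (lieDer x) ceD (ceD_lieDer x)]
        rw [map_aeval (lieDer x) (lieDer x) (lieDer x) (fun _ => rfl), e, map_zero, sub_zero]
      · rintro _ ⟨G, hG, rfl⟩
        refine ⟨⟨⟨hd _ _ hG.1, ?_⟩, ceD_ceD G⟩, ⟨G, hG.1, rfl⟩⟩
        change lieDer x _ = 0
        rw [← ceD_lieDer, LinearMap.mem_ker.1 hG.2, map_zero]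
    have h3 := Submodule.finrank_sup_add_finrank_inf_eq Z' B
    rw [← h1, h2] at h3
    change (finrank k Z : ℤ) - finrank k B = finrank k Z' - finrank k B'
    omega

end Dimensions

end LiePoset

namespace LiePoset

/-! ### Reduction to invariant and then to relative cochains -/

section Torus

open Module

variable {k L M : Type*} [Field k] [LieRing L] [LieAlgebra k L]
  [AddCommGroup M] [Module k M] [LieRingModule L M] [LieModule k L M] {ι : Type*}

/-- The cochains annihilated by the action of `H i` for all `i ∈ s`. -/
def invForms (H : ι → L) (s : Finset ι) (n : ℕ) : Submodule k (L [⋀^Fin n]→ₗ[k] M) :=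
  ⨅ i ∈ s, LinearMap.ker (lieDer (H i))

theorem mem_invForms {H : ι → L} {s : Finset ι} {n : ℕ} {F : L [⋀^Fin n]→ₗ[k] M} :
    F ∈ invForms H s n ↔ ∀ i ∈ s, lieDer (H i) F = 0 := by
  simp [invForms]

theorem contr_lieDer_of_lie_eq_zero {n : ℕ} {x y : L} (h : ⁅x, y⁆ = 0)
    (F : L [⋀^Fin (n + 1)]→ₗ[k] M) : contr y (lieDer x F) = lieDer x (contr y F) := by
  have h0 : contr (0 : L) F = 0 := F.curryLeft.map_zero
  rw [contr_lieDer, h, h0, sub_zero]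

theorem lieDer_comm_of_lie_eq_zero {n : ℕ} {x y : L} (h : ⁅x, y⁆ = 0)
    (F : L [⋀^Fin n]→ₗ[k] M) : lieDer x (lieDer y F) = lieDer y (lieDer x F) := by
  have h0 : lieDer (0 : L) F = 0 := by
    have := lieDer_smul_left (0 : k) (0 : L) F
    rwa [zero_smul, zero_smul] at this
  rw [lieDer_lieDer, h, h0, add_zero]

/-- The cochains annihilated by the action of all `H i` and by the contraction with `H i` for
`i ∈ s`. -/
def relForms [Fintype ι] (H : ι → L) (s : Finset ι) (n : ℕ) : Submodule k (L [⋀^Fin n]→ₗ[k] M) :=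
  invForms H Finset.univ n ⊓ ⨅ i ∈ s, kerContr (H i) n

theorem mem_relForms [Fintype ι] {H : ι → L} {s : Finset ι} {n : ℕ} {F : L [⋀^Fin n]→ₗ[k] M} :
    F ∈ relForms H s n ↔ (∀ i, lieDer (H i) F = 0) ∧ ∀ i ∈ s, F ∈ kerContr (H i) n := by
  simp [relForms, mem_invForms]

variable [FiniteDimensional k L] [FiniteDimensional k M]

/-- One element of the torus is treated at a time; commutativity keeps the subcomplex obtained so
far stable under the next one. -/
theorem cohomDim_invForms [DecidableEq ι] {H : ι → L} (hH : ∀ i j, ⁅H i, H j⁆ = 0)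
    (hq : ∀ i n, ∃ q : Polynomial k, ∀ m ≤ n, ∀ F : L [⋀^Fin m]→ₗ[k] M,
      lieDer (H i) (F - lieDer (H i) (Polynomial.aeval (lieDer (H i)) q F)) = 0)
    (s : Finset ι) (n : ℕ) :
    cohomDim (k := k) (L := L) (M := M) (fun _ => ⊤) n = cohomDim (invForms (k := k) (M := M) H s) n := by
  induction s using Finset.induction_on with
  | empty =>
    have : (fun _ => ⊤ : ∀ n, Submodule k (L [⋀^Fin n]→ₗ[k] M)) = invForms H ∅ := by
      funext n
      simp [invForms]
    rw [this]
  | insert j s hj ih =>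
    have h1 : (invForms H (insert j s) : ∀ n, Submodule k (L [⋀^Fin n]→ₗ[k] M)) =
        fun m => invForms H s m ⊓ LinearMap.ker (lieDer (H j)) := by
      funext m
      rw [invForms, Finset.iInf_insert, inf_comm, invForms]
    rw [ih, h1]
    refine cohomDim_inf_ker_lieDer _ _ ?_ ?_ ?_ (hq j) n
    · intro n F hF
      rw [mem_invForms] at hF ⊢
      intro i hi
      rw [lieDer_comm_of_lie_eq_zero (hH i j), hF i hi, map_zero]
    · intro n F hF
      rw [mem_invForms] at hF ⊢
      intro i hi
      rw [← contr_lieDer_of_lie_eq_zero (hH i j), hF i hi, map_zero]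
    · intro n F hF
      rw [mem_invForms] at hF ⊢
      intro i hi
      rw [← ceD_lieDer, hF i hi, map_zero]

/-- Each `H j` splits off one factor. Duality of `ξ` and `H` on `s` ensures that multiplication by
`ξ j` preserves the contraction conditions already imposed. -/
theorem cohomSeries_relForms [Fintype ι] [DecidableEq ι] {H : ι → L}
    (hH : ∀ i j, ⁅H i, H j⁆ = 0) {ξ : ι → L →ₗ[k] k} (hξ : ∀ i, ∀ y z : L, ξ i ⁅y, z⁆ = 0)
    (s : Finset ι) (hs : ∀ i ∈ s, ∀ j ∈ s, ξ i (H j) = if i = j then 1 else 0) :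
    cohomSeries (invForms (k := k) (M := M) H Finset.univ) =
      (1 + PowerSeries.X) ^ s.card * cohomSeries (relForms (k := k) (M := M) H s) := by
  induction s using Finset.induction_on with
  | empty =>
    have : (invForms H Finset.univ : ∀ n, Submodule k (L [⋀^Fin n]→ₗ[k] M)) = relForms H ∅ := by
      funext n
      simp [relForms]
    rw [this, Finset.card_empty, pow_zero, one_mul]
  | insert j s hj ih =>
    have h1 : (relForms H (insert j s) : ∀ n, Submodule k (L [⋀^Fin n]→ₗ[k] M)) =
        fun m => relForms H s m ⊓ kerContr (H j) m := by
      funext m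
      rw [relForms, Finset.iInf_insert, inf_comm (kerContr (H j) m), ← inf_assoc, relForms]
    rw [ih fun i hi l hl => hs i (Finset.mem_insert_of_mem hi) l (Finset.mem_insert_of_mem hl), h1,
      Finset.card_insert_of_notMem hj, pow_succ, mul_assoc]
    congr 1
    have hjj : ξ j (H j) = 1 := by
      rw [hs j (Finset.mem_insert_self _ _) j (Finset.mem_insert_self _ _), if_pos rfl]
    refine cohomSeries_eq_mul _ hjj (hξ j) (fun n F hF => (mem_relForms.1 hF).1 j) ?_ ?_
    · intro n F hF
      rw [mem_relForms] at hF ⊢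
      refine ⟨fun i => ?_, fun i hi => ?_⟩
      · rw [← contr_lieDer_of_lie_eq_zero (hH i j), hF.1 i, map_zero]
      · cases n with
        | zero => trivial
        | succ n =>
          rw [mem_kerContr_succ, contr_anticomm, mem_kerContr_succ.1 (hF.2 i hi), map_zero,
            neg_zero]
    · intro n F hF
      rw [mem_relForms] at hF ⊢
      refine ⟨fun i => ?_, fun i hi => ?_⟩
      · rw [lieDer_wedge _ (hξ j), hF.1 i, map_zero]
      · have h0 : ξ j (H i) = 0 := by
          rw [hs j (Finset.mem_insert_self _ _) i (Finset.mem_insert_of_mem hi), if_neg]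
          rintro rfl
          exact hj hi
        rw [mem_kerContr_succ]
        cases n with
        | zero => rw [contr_wedge_zero, h0, zero_smul]
        | succ n =>
          rw [contr_wedge_succ, h0, zero_smul, mem_kerContr_succ.1 (hF.2 i hi), map_zero, sub_zero]

/-- With $p$ the product of $X-a$ over the nonzero $a\in S$ and $p=p(0)+Xr$, the polynomial
$q=-r/p(0)$ inverts every nonzero $w\in S$. -/
theorem exists_polynomial_of_finset (S : Finset k) : ∃ q : Polynomial k,
    ∀ w ∈ S, w * (1 - w * q.eval w) = 0 := by
  classical
  let p : Polynomial k := ∏ a ∈ S.erase 0, (Polynomial.X - Polynomial.C a)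
  have hp0 : p.eval 0 ≠ 0 := by
    simp only [p, Polynomial.eval_prod, Polynomial.eval_sub, Polynomial.eval_X, Polynomial.eval_C]
    rw [Finset.prod_ne_zero_iff]
    intro a ha
    simpa using (Finset.ne_of_mem_erase ha)
  obtain ⟨r, hr⟩ : Polynomial.X ∣ (p - Polynomial.C (p.eval 0)) := by
    rw [Polynomial.X_dvd_iff, Polynomial.coeff_zero_eq_eval_zero]
    simp
  refine ⟨Polynomial.C (-(p.eval 0)⁻¹) * r, fun w hw => ?_⟩
  by_cases h0 : w = 0
  · simp [h0]
  have hpw : p.eval w = 0 := by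
    simp only [p, Polynomial.eval_prod]
    exact Finset.prod_eq_zero (Finset.mem_erase.2 ⟨h0, hw⟩) (by simp)
  have h1 := congrArg (Polynomial.eval w) hr
  simp only [Polynomial.eval_sub, Polynomial.eval_mul, Polynomial.eval_X, Polynomial.eval_C, hpw]
    at h1
  simp only [Polynomial.eval_mul, Polynomial.eval_C]
  have h2 : w * (-(p.eval 0)⁻¹ * r.eval w) = 1 := by
    rw [mul_left_comm, ← h1, zero_sub, neg_mul_neg, inv_mul_cancel₀ hp0]
  rw [h2, sub_self, mul_zero]

end Torus

end LiePoset

namespace LiePoset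

/-! ### Weights and flows along edges of the poset -/

section Paths

theorem natCast_injOn_of_le {k : Type*} [Field k] {N : ℕ} (hk : ringChar k = 0 ∨ N < ringChar k)
    {m n : ℕ} (hm : m ≤ N) (hn : n ≤ N) (h : (m : k) = n) : m = n := by
  wlog hmn : m ≤ n generalizing m n
  · exact (this hn hm h.symm (le_of_not_ge hmn)).symm
  have h1 : ((n - m : ℕ) : k) = 0 := by rw [Nat.cast_sub hmn, h, sub_self]
  have h2 := (ringChar.spec k _).1 h1
  have h3 : n - m = 0 := by
    rcases hk with hk | hk
    · rw [hk, zero_dvd_iff] at h2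
      exact h2
    · exact Nat.eq_zero_of_dvd_of_lt h2 (by omega)
  omega

variable {P : Type*} [PartialOrder P] [DecidableEq P]

/-- The weights of the weight vectors. -/
def weight (p : P) : P ⊕ {e : P × P // e.1 < e.2} → ℤ
  | Sum.inl _ => 0
  | Sum.inr e => (if e.1.1 = p then 1 else 0) - (if e.1.2 = p then 1 else 0)

/-- The weight of the component of a cochain for the arguments `x` and the matrix entry
`(a, b)`. -/
def formWeight {n : ℕ} (p : P) (x : Fin n → P ⊕ {e : P × P // e.1 < e.2}) (a b : P) : ℤ :=
  (if a = p then 1 else 0) - (if b = p then 1 else 0) - ∑ l, weight p (x l)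

theorem abs_formWeight_le {n : ℕ} (p : P) (x : Fin n → P ⊕ {e : P × P // e.1 < e.2}) (a b : P) :
    |formWeight p x a b| ≤ n + 1 := by
  have h1 : ∀ w : P ⊕ {e : P × P // e.1 < e.2}, |weight p w| ≤ 1 := by
    rintro (i | e)
    · simp [weight]
    · simp only [weight]
      split_ifs <;> simp
  have h2 : |∑ l, weight p (x l)| ≤ n := by
    refine (Finset.abs_sum_le_sum_abs _ _).trans ((Finset.sum_le_sum fun l _ => h1 (x l)).trans ?_)
    simp
  have h3 : |(if a = p then (1 : ℤ) else 0) - (if b = p then 1 else 0)| ≤ 1 := by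
    split_ifs <;> simp
  rw [formWeight]
  refine (abs_sub _ _).trans ?_
  linarith

/-- A family of edges of a poset with the boundary of a path from `a` to `b` is the family of edges
of a chain from `a` to `b`, up to a permutation. -/
theorem exists_chain_of_flow : ∀ (n : ℕ) (x : Fin n → P × P) (_ : ∀ l, (x l).1 < (x l).2) (a b : P)
    (_ : ∀ i, (∑ l, if (x l).1 = i then 1 else 0) + (if b = i then 1 else 0) =
      (∑ l, if (x l).2 = i then 1 else 0) + (if a = i then 1 else 0)),
    ∃ c : Chain P (n + 1), c.1 0 = a ∧ c.1 (Fin.last n) = b ∧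
      ∃ σ : Equiv.Perm (Fin n), ∀ l, x (σ l) = (c.1 l.castSucc, c.1 l.succ) := by
  intro n
  induction n with
  | zero =>
    intro x _ a b h
    have hab : a = b := by
      have := h a
      by_contra hne
      simp [Ne.symm hne] at this
    subst hab
    exact ⟨⟨fun _ => a, Subsingleton.strictMono (α := Fin 1) _⟩, rfl, rfl, 1, fun l => l.elim0⟩
  | succ n ih =>
    intro x hx a b h
    -- No edge ends at a minimal source, so the balance there forces it to be `a`. Removing an edge
    -- that starts there leaves a flow from its endpoint to `b`.
    obtain ⟨m, hm⟩ := (Finset.univ.image fun l => (x l).1).exists_minimal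
      ⟨_, Finset.mem_image_of_mem _ (Finset.mem_univ 0)⟩
    obtain ⟨l, -, rfl⟩ := Finset.mem_image.1 hm.1
    have hin : (∑ l', if (x l').2 = (x l).1 then 1 else 0) = 0 := by
      refine Finset.sum_eq_zero fun l' _ => if_neg fun h' => ?_
      have h1 : (x l').1 < (x l).1 := h' ▸ hx l'
      exact h1.not_ge (hm.2 (Finset.mem_image_of_mem _ (Finset.mem_univ l')) h1.le)
    have ha : a = (x l).1 := by
      have h1 := h (x l).1
      rw [hin, Fin.sum_univ_succAbove _ l, if_pos rfl] at h1
      by_contra hne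
      rw [if_neg hne] at h1
      omega
    subst ha
    obtain ⟨c, hc0, hcl, σ, hσ⟩ := ih (fun m => x (l.succAbove m)) (fun m => hx _) (x l).2 b
      (fun i => by
        have h1 := h i
        rw [Fin.sum_univ_succAbove _ l, Fin.sum_univ_succAbove _ l] at h1
        omega)
    refine ⟨⟨Fin.cons (x l).1 c.1, ?_⟩, rfl, ?_, ?_⟩
    · refine Fin.strictMono_iff_lt_succ.2 fun i => ?_
      cases i using Fin.cases with
      | zero => simpa [hc0] using hx l
      | succ i =>
        rw [← Fin.succ_castSucc, Fin.cons_succ, Fin.cons_succ]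
        exact c.2 Fin.castSucc_lt_succ
    · rw [← Fin.succ_last]
      exact hcl
    · refine ⟨((finSuccEquiv n).trans σ.optionCongr).trans (finSuccEquiv' l).symm, fun i => ?_⟩
      cases i using Fin.cases with
      | zero =>
        simp [hc0]
      | succ i =>
        simp [hσ]

/-- Distinct edges leaving (or entering) `i` have distinct other endpoints, none equal to `i`: at
most $N-1$ of them, plus one for the extra indicator. This is the bound that the characteristic must
exceed. -/
theorem sum_edges_le [Fintype P] {n : ℕ} {x : Fin n → P × P} (hx : ∀ l, (x l).1 < (x l).2)
    (hinj : Function.Injective x) (i j : P) :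
    (∑ l, if (x l).1 = i then 1 else 0) + (if j = i then 1 else 0) ≤ Fintype.card P ∧
    (∑ l, if (x l).2 = i then 1 else 0) + (if j = i then 1 else 0) ≤ Fintype.card P := by
  have hP : (Finset.univ.erase i).card + 1 = Fintype.card P :=
    Finset.card_erase_add_one (Finset.mem_univ i)
  have h1 : (∑ l, if (x l).1 = i then 1 else 0) ≤ (Finset.univ.erase i).card := by
    rw [← Finset.card_filter]
    refine Finset.card_le_card_of_injOn (fun l => (x l).2) ?_ ?_
    · intro l hl
      have hl' : (x l).1 = i := by simpa using hl
      have := hx l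
      rw [hl'] at this
      simpa using this.ne'
    · intro l hl l' hl' h
      have e1 : (x l).1 = i := by simpa using hl
      have e2 : (x l').1 = i := by simpa using hl'
      exact hinj (Prod.ext (e1.trans e2.symm) h)
  have h2 : (∑ l, if (x l).2 = i then 1 else 0) ≤ (Finset.univ.erase i).card := by
    rw [← Finset.card_filter]
    refine Finset.card_le_card_of_injOn (fun l => (x l).1) ?_ ?_
    · intro l hl
      have hl' : (x l).2 = i := by simpa using hl
      have := hx l
      rw [hl'] at this
      simpa using this.ne
    · intro l hl l' hl' h
      have e1 : (x l).2 = i := by simpa using hl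
      have e2 : (x l').2 = i := by simpa using hl'
      exact hinj (Prod.ext h (e1.trans e2.symm))
  split_ifs <;> omega

end Paths

end LiePoset

namespace LiePoset

/-! ### Matrix units and the torus action in $\mathfrak g(P)$ -/

section PosetAlgebra

variable {k P : Type*} [Field k] [PartialOrder P] [Fintype P] [DecidableEq P]

/-- The matrix entry at `(a, b)`, as a linear form. -/
def entry (a b : P) : lieAlg k P →ₗ[k] k where
  toFun X := X.1 a b
  map_add' _ _ := rfl
  map_smul' _ _ := rfl

theorem ext_entry {X Y : lieAlg k P} (h : ∀ a b, entry a b X = entry a b Y) : X = Y :=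
  Subtype.ext (Matrix.ext h)

theorem entry_eq_zero (X : lieAlg k P) {a b : P} (h : ¬ a ≤ b) : entry a b X = 0 :=
  X.2.1 a b h

theorem sum_entry_diag (X : lieAlg k P) : ∑ a, entry a a X = 0 :=
  X.2.2

theorem entry_lie (X Y : lieAlg k P) (a b : P) :
    entry a b ⁅X, Y⁆ = ∑ c, (entry a c X * entry c b Y - entry a c Y * entry c b X) := by
  change (⁅X.1, Y.1⁆ : Matrix P P k) a b = _
  rw [Ring.lie_def, Matrix.sub_apply, Matrix.mul_apply, Matrix.mul_apply, ← Finset.sum_sub_distrib]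
  rfl

/-- The matrix unit `e_{ij}` for `i < j`. -/
def unit {i j : P} (h : i < j) : lieAlg k P :=
  ⟨Matrix.single i j 1, fun a b hab => by
    rw [Matrix.single_apply, if_neg]
    rintro ⟨rfl, rfl⟩
    exact hab h.le, by simp [h.ne]⟩

theorem entry_unit {i j : P} (h : i < j) (a b : P) :
    (entry a b (unit h : lieAlg k P) : k) = if i = a ∧ j = b then 1 else 0 := by
  change Matrix.single i j (1 : k) a b = _
  rw [Matrix.single_apply]

theorem entry_unit_lie {i j : P} (h : i < j) (X : lieAlg k P) (a b : P) :
    entry a b ⁅(unit h : lieAlg k P), X⁆ =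
      (if i = a then entry j b X else 0) - (if j = b then entry a i X else 0) := by
  rw [entry_lie, Finset.sum_sub_distrib]
  congr 1
  · simp only [entry_unit, ite_and]
    split_ifs with h1 <;> simp
  · simp only [entry_unit, ite_and]
    split_ifs with h1 <;> simp

/-- By antisymmetry only the term $c=a$ can survive, and scalars commute. Diagonal entries thus
provide the invariant forms used to split off the torus. -/
theorem entry_diag_lie (a : P) (X Y : lieAlg k P) : (entry a a ⁅X, Y⁆ : k) = 0 := by
  rw [entry_lie]
  refine Finset.sum_eq_zero fun c _ => ?_
  by_cases h1 : a ≤ c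
  · by_cases h2 : c ≤ a
    · rw [le_antisymm h1 h2]
      ring
    · simp [entry_eq_zero _ h2]
  · simp [entry_eq_zero _ h1]

theorem unit_lie_unit {i j l : P} (h : i < j) (h' : j < l) :
    ⁅(unit h : lieAlg k P), (unit h' : lieAlg k P)⁆ = unit (h.trans h') := by
  refine ext_entry fun a b => ?_
  rw [entry_unit_lie]
  simp only [entry_unit]
  have := (h.trans h').ne
  split_ifs <;> simp_all

theorem unit_lie_unit_of_ne {i j i' j' : P} (h : i < j) (h' : i' < j') (h1 : j ≠ i') (h2 : j' ≠ i) :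
    ⁅(unit h : lieAlg k P), (unit h' : lieAlg k P)⁆ = 0 := by
  refine ext_entry fun a b => ?_
  rw [entry_unit_lie, map_zero]
  simp [entry_unit, h1.symm, h2]

/-- The diagonal matrix `diag(t)` projected to the matrices of trace zero. -/
def diagEl (hN : (Fintype.card P : k) ≠ 0) : (P → k) →ₗ[k] lieAlg k P where
  toFun t := ⟨Matrix.diagonal fun i => t i - (Fintype.card P : k)⁻¹ * ∑ j, t j,
    fun a b hab => Matrix.diagonal_apply_ne _ fun h => hab h.le, by
      rw [Matrix.trace_diagonal, Finset.sum_sub_distrib]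
      simp [hN]⟩
  map_add' s t := by
    refine Subtype.ext (Matrix.ext fun a b => ?_)
    rcases eq_or_ne a b with rfl | h
    · simp [Finset.sum_add_distrib]
      ring
    · simp [h]
  map_smul' c t := by
    refine Subtype.ext (Matrix.ext fun a b => ?_)
    rcases eq_or_ne a b with rfl | h
    · simp [← Finset.mul_sum]
      ring
    · simp [h]

variable (hN : (Fintype.card P : k) ≠ 0)

theorem entry_diagEl (t : P → k) (a b : P) : entry a b (diagEl hN t) =
    if a = b then t a - (Fintype.card P : k)⁻¹ * ∑ j, t j else 0 := by
  change Matrix.diagonal _ a b = _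
  rw [Matrix.diagonal_apply]

theorem entry_diagEl_lie (t : P → k) (X : lieAlg k P) (a b : P) :
    entry a b ⁅diagEl hN t, X⁆ = (t a - t b) * entry a b X := by
  rw [entry_lie, Finset.sum_sub_distrib]
  simp only [entry_diagEl]
  simp
  ring

theorem diagEl_lie_diagEl (s t : P → k) : ⁅diagEl hN s, diagEl hN t⁆ = 0 := by
  refine ext_entry fun a b => ?_
  rw [entry_diagEl_lie, entry_diagEl, map_zero]
  split_ifs with h
  · rw [h, sub_self, zero_mul]
  · rw [mul_zero]

theorem diagEl_lie_unit (t : P → k) {i j : P} (h : i < j) :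
    ⁅diagEl hN t, (unit h : lieAlg k P)⁆ = (t i - t j) • unit h := by
  refine ext_entry fun a b => ?_
  rw [entry_diagEl_lie, map_smul, entry_unit, smul_eq_mul]
  split_ifs with h
  · rw [h.1, h.2]
  · simp

/-- The diagonal matrix unit `e_{ii}` projected to the matrices of trace zero. -/
def cartanEl (i : P) : lieAlg k P := diagEl hN (Pi.single i 1)

theorem diagEl_eq_sum (t : P → k) : diagEl hN t = ∑ i, t i • cartanEl hN i := by
  conv_lhs => rw [pi_eq_sum_univ' t]
  simp only [map_sum, map_smul, cartanEl]

theorem sum_cartanEl : ∑ i, cartanEl hN i = 0 := by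
  have h := diagEl_eq_sum hN (fun _ : P => 1)
  simp only [one_smul] at h
  rw [← h]
  refine ext_entry fun a b => ?_
  rw [entry_diagEl]
  simp [hN]

/-- The weight vectors of the Cartan subalgebra: the projected diagonal matrix units and the matrix
units `e_{ij}` for `i < j`. -/
def weightVec : P ⊕ {e : P × P // e.1 < e.2} → lieAlg k P
  | Sum.inl i => cartanEl hN i
  | Sum.inr e => unit e.2

theorem cartanEl_lie_weightVec (p : P) (w : P ⊕ {e : P × P // e.1 < e.2}) :
    ⁅cartanEl hN p, weightVec hN w⁆ = (weight p w : k) • weightVec hN w := by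
  cases w with
  | inl i => simp [weightVec, weight, cartanEl, diagEl_lie_diagEl]
  | inr e => simp [weightVec, weight, cartanEl, diagEl_lie_unit, Pi.single_apply]

/-- The projected diagonal units sum to zero, so the weight vectors are no basis; spanning is enough
to test forms. -/
theorem mem_span_weightVec (X : lieAlg k P) : X ∈ Submodule.span k (Set.range (weightVec hN)) := by
  classical
  have h : X = diagEl hN (fun i => entry i i X) +
      ∑ e : {e : P × P // e.1 < e.2}, entry e.1.1 e.1.2 X • unit e.2 := by
    refine ext_entry fun a b => ?_
    rw [map_add, map_sum, entry_diagEl, sum_entry_diag]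
    simp only [map_smul, entry_unit, smul_eq_mul, mul_ite, mul_one, mul_zero]
    by_cases hab : a = b
    · subst hab
      rw [if_pos rfl, Finset.sum_eq_zero]
      · ring
      · rintro ⟨e, he⟩ _
        rw [if_neg]
        rintro ⟨rfl, h⟩
        exact he.ne h.symm
    · rw [if_neg hab, zero_add]
      by_cases hlt : a < b
      · rw [Finset.sum_eq_single ⟨(a, b), hlt⟩]
        · simp
        · rintro ⟨⟨e1, e2⟩, he⟩ _ hne
          rw [if_neg]
          rintro ⟨rfl, rfl⟩
          exact hne rfl
        · simp
      · rw [entry_eq_zero X fun h => hlt (lt_of_le_of_ne h hab), Finset.sum_eq_zero]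
        rintro ⟨⟨e1, e2⟩, he⟩ _
        rw [if_neg]
        rintro ⟨rfl, rfl⟩
        exact hlt he
  rw [h, diagEl_eq_sum]
  refine add_mem (Submodule.sum_mem _ fun i _ => Submodule.smul_mem _ _ ?_)
    (Submodule.sum_mem _ fun e _ => Submodule.smul_mem _ _ ?_)
  · exact Submodule.subset_span ⟨Sum.inl i, rfl⟩
  · exact Submodule.subset_span ⟨Sum.inr e, rfl⟩

theorem form_ext_weightVec {M : Type*} [AddCommGroup M] [Module k M] {n : ℕ}
    {F : lieAlg k P [⋀^Fin n]→ₗ[k] M}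
    (h : ∀ x : Fin n → P ⊕ {e : P × P // e.1 < e.2}, F (fun l => weightVec hN (x l)) = 0) :
    F = 0 := by
  induction n with
  | zero =>
    ext g
    rw [Subsingleton.elim g fun l : Fin 0 => weightVec hN (l.elim0)]
    exact h _
  | succ n ih =>
    have h0 : ∀ w, F.curryLeft (weightVec hN w) = 0 := by
      intro w
      refine ih fun x => ?_
      rw [AlternatingMap.curryLeft_apply_apply, ← h (Fin.cons w x)]
      congr 1
      funext l
      cases l using Fin.cases <;> rfl
    refine ext_contr fun X => ?_
    have : Submodule.span k (Set.range (weightVec hN)) ≤ LinearMap.ker F.curryLeft := by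
      rw [Submodule.span_le]
      rintro _ ⟨w, rfl⟩
      exact h0 w
    exact this (mem_span_weightVec hN X)

theorem entry_lieDer_weightVec {n : ℕ} (p : P) (x : Fin n → P ⊕ {e : P × P // e.1 < e.2})
    (F : lieAlg k P [⋀^Fin n]→ₗ[k] lieAlg k P) (a b : P) :
    entry a b (lieDer (cartanEl hN p) F fun l => weightVec hN (x l)) =
      (formWeight p x a b : k) * entry a b (F fun l => weightVec hN (x l)) := by
  rw [lieDer_apply]
  have h : ∀ l, F (Function.update (fun l => weightVec hN (x l)) l
      ⁅cartanEl hN p, weightVec hN (x l)⁆) =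
      (weight p (x l) : k) • F fun l => weightVec hN (x l) := by
    intro l
    rw [cartanEl_lie_weightVec, AlternatingMap.map_update_smul, Function.update_eq_self]
  simp only [h, ← Finset.sum_smul]
  rw [map_sub, map_smul, cartanEl, entry_diagEl_lie, formWeight, smul_eq_mul]
  push_cast
  simp only [Pi.single_apply]
  ring

/-- In coordinates on weight vectors the action is multiplication by images of integers in
$[-(n+1),n+1]$. This needs only that $N$ is invertible: the weights may collide in $\mathbf k$. -/
theorem cartanEl_semisimple (p : P) (n : ℕ) : ∃ q : Polynomial k, ∀ m ≤ n,
    ∀ F : lieAlg k P [⋀^Fin m]→ₗ[k] lieAlg k P, lieDer (cartanEl hN p)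
      (F - lieDer (cartanEl hN p) (Polynomial.aeval (lieDer (cartanEl hN p)) q F)) = 0 := by
  classical
  obtain ⟨q, hq⟩ := exists_polynomial_of_finset
    ((Finset.Icc (-(n + 1 : ℤ)) (n + 1)).image (Int.cast : ℤ → k))
  refine ⟨q, fun m hm F => form_ext_weightVec hN fun x => ext_entry fun a b => ?_⟩
  have hw : (formWeight p x a b : k) ∈
      (Finset.Icc (-(n + 1 : ℤ)) (n + 1)).image (Int.cast : ℤ → k) := by
    refine Finset.mem_image_of_mem _ (Finset.mem_Icc.2 (abs_le.1 ?_))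
    refine (abs_formWeight_le p x a b).trans ?_
    exact_mod_cast Nat.succ_le_succ hm
  have hae : entry a b (Polynomial.aeval (lieDer (cartanEl hN p)) q F
      fun l => weightVec hN (x l)) = q.eval (formWeight p x a b : k) *
        entry a b (F fun l => weightVec hN (x l)) := by
    let φ : (lieAlg k P [⋀^Fin m]→ₗ[k] lieAlg k P) →ₗ[k] k :=
      { toFun := fun G => entry a b (G fun l => weightVec hN (x l))
        map_add' := fun G G' => by rw [AlternatingMap.add_apply, map_add]
        map_smul' := fun c G => by rw [AlternatingMap.smul_apply, map_smul]; rfl }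
    have h := map_aeval (lieDer (cartanEl hN p))
      (algebraMap k (Module.End k k) (formWeight p x a b)) φ
      (fun G => entry_lieDer_weightVec hN p x G a b) q F
    rw [Polynomial.aeval_algebraMap_apply] at h
    exact h
  rw [entry_lieDer_weightVec, AlternatingMap.sub_apply, map_sub, entry_lieDer_weightVec, hae,
    map_zero]
  linear_combination (entry a b (F fun l => weightVec hN (x l))) * hq _ hw

end PosetAlgebra

end LiePoset

namespace LiePoset

/-! ### Evaluation on chains is a cochain map -/

section ChainEvaluation

/-- The vertices of a chain. -/
def Chain.vertex {P : Type*} [PartialOrder P] {m : ℕ} (c : Chain P m) : Fin m → P := c.1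

theorem Chain.vertex_lt {P : Type*} [PartialOrder P] {m : ℕ} (c : Chain P m) {i j : Fin m}
    (h : i < j) : c.vertex i < c.vertex j := c.2 h

theorem Chain.vertex_face {P : Type*} [PartialOrder P] {m : ℕ} (c : Chain P (m + 1))
    (i : Fin (m + 1)) (l : Fin m) : (c.face i).vertex l = c.vertex (i.succAbove l) := rfl

theorem Chain.ext_vertex {P : Type*} [PartialOrder P] {m : ℕ} {c c' : Chain P m}
    (h : ∀ l, c.vertex l = c'.vertex l) : c = c' :=
  Subtype.ext (funext h)

theorem face_face_zero {P : Type*} [PartialOrder P] {m : ℕ} (c : Chain P (m + 2)) (i : Fin (m + 1)) :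
    (c.face i.succ).face 0 = (c.face 0).face i :=
  Chain.ext_vertex fun l => by simp [Chain.vertex_face, Fin.succ_succAbove_succ]

theorem nerveDelta_apply {k P : Type*} [CommRing k] [PartialOrder P] {m : ℕ}
    (f : Chain P m → k) (c : Chain P (m + 1)) :
    nerveDelta k P m f c = ∑ i : Fin (m + 1), (-1 : k) ^ (i : ℕ) * f (c.face i) := rfl

variable {k P : Type*} [Field k] [PartialOrder P] [Fintype P] [DecidableEq P]

theorem unit_congr {i j i' j' : P} (hi : i = i') (hj : j = j') (h : i < j) (h' : i' < j') :
    (unit h : lieAlg k P) = unit h' := by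
  subst hi hj
  rfl

/-- The matrix units of the edges of a chain. -/
def units {m : ℕ} (c : Chain P (m + 1)) (l : Fin m) : lieAlg k P :=
  unit (c.vertex_lt (Fin.castSucc_lt_succ (i := l)))

theorem units_apply {m : ℕ} (c : Chain P (m + 1)) (l : Fin m) :
    (units c l : lieAlg k P) = unit (c.vertex_lt (Fin.castSucc_lt_succ (i := l))) := rfl

/-- The matrix unit of the first edge of a chain. -/
def firstUnit {m : ℕ} (c : Chain P (m + 2)) : lieAlg k P :=
  unit (c.vertex_lt (i := 0) (j := 1) (by simp))

theorem entry_firstUnit_lie {m : ℕ} (c : Chain P (m + 2)) (X : lieAlg k P) (a b : P) :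
    entry a b ⁅(firstUnit c : lieAlg k P), X⁆ = (if c.vertex 0 = a then entry (c.vertex 1) b X else 0) -
      (if c.vertex 1 = b then entry a (c.vertex 0) X else 0) :=
  entry_unit_lie _ _ _ _

theorem units_succ {m : ℕ} (c : Chain P (m + 2)) :
    (units c : Fin (m + 1) → lieAlg k P) = Fin.cons (firstUnit c) (units (c.face 0)) := by
  funext l
  cases l using Fin.cases with
  | zero => rfl
  | succ l =>
    rw [Fin.cons_succ, units_apply, units_apply]
    exact unit_congr (by simp [Chain.vertex_face]) (by simp [Chain.vertex_face]) _ _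

theorem update_units_face_zero {m : ℕ} (c : Chain P (m + 3)) :
    Function.update (units (c.face 0) : Fin (m + 1) → lieAlg k P) 0
      ⁅(firstUnit c : lieAlg k P), (units (c.face 0) 0 : lieAlg k P)⁆ = units (c.face 1) := by
  funext l
  cases l using Fin.cases with
  | zero =>
    rw [Function.update_self]
    exact (unit_lie_unit _ ((c.face 0).vertex_lt
      (Fin.castSucc_lt_succ (i := (0 : Fin (m + 1)))))).trans (unit_congr rfl rfl _ _)
  | succ l =>
    rw [Function.update_of_ne (Fin.succ_ne_zero l), units_apply, units_apply]
    refine unit_congr ?_ ?_ _ _ <;>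
      simp [Chain.vertex_face, Fin.succAbove, Fin.lt_def]

theorem firstUnit_face {m : ℕ} (c : Chain P (m + 3)) (i : Fin (m + 1)) :
    (firstUnit (c.face i.succ.succ) : lieAlg k P) = firstUnit c :=
  unit_congr (by simp [Chain.vertex_face]) (by simp [Chain.vertex_face, Fin.succAbove, Fin.lt_def])
    _ _

/-- The row `a` is allowed to lie below the first vertex because the induction passes to the face
opposite that vertex while keeping the row. -/
theorem entry_ceD_units {m : ℕ} (c : Chain P (m + 2)) (G : lieAlg k P [⋀^Fin m]→ₗ[k] lieAlg k P)
    (a : P) (ha : a ≤ c.vertex 0) :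
    entry a (c.vertex (Fin.last _)) (ceD G (units c)) =
      (if c.vertex 0 = a then
        entry (c.vertex 1) (c.vertex (Fin.last _)) (G (units (c.face 0))) else 0) +
      ∑ i : Fin (m + 1), (-1) ^ ((i : ℕ) + 1) *
        entry a ((c.face i.succ).vertex (Fin.last m)) (G (units (c.face i.succ))) := by
  induction m with
  | zero =>
    have e : ∀ i, (units (c.face i) : Fin 0 → lieAlg k P) = units (c.face 0) :=
      fun i => Subsingleton.elim _ _
    rw [units_succ, ← contr_apply, contr_ceD_zero, lieDer_apply, map_sub, entry_firstUnit_lie]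
    simp only [e]
    simp [Chain.vertex_face, sub_eq_add_neg]
  | succ m ih =>
    have hlast : c.vertex 1 ≠ c.vertex (Fin.last (m + 2)) :=
      (c.vertex_lt (by simp [Fin.lt_def])).ne
    have hlast' : (c.face 0).vertex (Fin.last (m + 1)) = c.vertex (Fin.last (m + 2)) := by
      simp [Chain.vertex_face]
    have h01 : (c.face 0).vertex 0 = c.vertex 1 := by simp [Chain.vertex_face]
    have ha' : a < c.vertex 1 := lt_of_le_of_lt ha (c.vertex_lt (by simp))
    have h1 : ∑ l, G (Function.update (units (c.face 0)) l
        ⁅(firstUnit c : lieAlg k P), (units (c.face 0) l : lieAlg k P)⁆) =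
        G (units (c.face 1)) := by
      rw [Fin.sum_univ_succ, update_units_face_zero, Finset.sum_eq_zero, add_zero]
      intro l _
      refine G.map_coord_zero l.succ ?_
      rw [Function.update_self]
      refine unit_lie_unit_of_ne _ _ (ne_of_lt ?_) (ne_of_gt ?_)
      · exact c.vertex_lt (by simp [Fin.lt_def, Fin.succAbove])
      · exact c.vertex_lt (by simp [Fin.lt_def, Fin.succAbove])
    have h2 := ih (c.face 0) (contr (firstUnit c) G) (by rw [h01]; exact ha'.le)
    rw [if_neg (by rw [h01]; exact ha'.ne'), zero_add, hlast'] at h2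
    -- Cartan's formula for the first edge: its action on the value gives face 0, its bracket with
    -- the second edge gives face 1 (other brackets vanish), and the induction hypothesis supplies
    -- the remaining faces.
    rw [units_succ, ← contr_apply, contr_ceD_succ, AlternatingMap.sub_apply, lieDer_apply, map_sub,
      map_sub, h1, h2]
    rw [entry_firstUnit_lie]
    conv_rhs => rw [Fin.sum_univ_succ]
    rw [if_neg hlast, sub_zero, sub_sub, sub_eq_add_neg, neg_add]
    congr 1
    congr 1
    · simp [Chain.vertex_face, Fin.succAbove, Fin.lt_def]
    · rw [← Finset.sum_neg_distrib]
      refine Finset.sum_congr rfl fun i _ => ?_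
      rw [units_succ (c.face i.succ.succ), firstUnit_face, face_face_zero, contr_apply]
      have e : (c.face i.succ.succ).vertex (Fin.last (m + 1)) =
          ((c.face 0).face i.succ).vertex (Fin.last m) := by
        rw [← face_face_zero]
        simp [Chain.vertex_face]
      rw [e, Fin.val_succ, pow_succ _ ((i : ℕ) + 1)]
      ring

/-- Evaluation of a cochain on the matrix units of the edges of chains. -/
def chainEval {m : ℕ} : (lieAlg k P [⋀^Fin m]→ₗ[k] lieAlg k P) →ₗ[k] (Chain P (m + 1) → k) where
  toFun F c := entry (c.vertex 0) (c.vertex (Fin.last m)) (F (units c))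
  map_add' F G := by
    funext c
    rw [AlternatingMap.add_apply, map_add]
    rfl
  map_smul' a F := by
    funext c
    rw [AlternatingMap.smul_apply, map_smul]
    rfl

theorem chainEval_apply {m : ℕ} (F : lieAlg k P [⋀^Fin m]→ₗ[k] lieAlg k P) (c : Chain P (m + 1)) :
    chainEval F c = entry (c.vertex 0) (c.vertex (Fin.last m)) (F (units c)) := rfl

theorem chainEval_ceD {m : ℕ} (F : lieAlg k P [⋀^Fin m]→ₗ[k] lieAlg k P) :
    chainEval (ceD F) = nerveDelta k P (m + 1) (chainEval F) := by
  funext c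
  rw [chainEval_apply, entry_ceD_units c F _ le_rfl, if_pos rfl, nerveDelta_apply]
  conv_rhs => rw [Fin.sum_univ_succ]
  congr 1
  rw [chainEval_apply]
  simp [Chain.vertex_face]

end ChainEvaluation

end LiePoset

namespace LiePoset

/-! ### Relative cochains are functions on chains -/

section RelativeCochains

open Module

theorem apply_eq_zero_of_mem_kerContr {k L M : Type*} [Field k] [LieRing L] [LieAlgebra k L]
    [AddCommGroup M] [Module k M] {n : ℕ} {x : L} {F : L [⋀^Fin n]→ₗ[k] M}
    (hF : F ∈ kerContr x n) {g : Fin n → L} {l : Fin n} (h : g l = x) : F g = 0 := by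
  cases n with
  | zero => exact l.elim0
  | succ n =>
    have h1 : F (Fin.cons x fun m => g (l.succAbove m)) = 0 :=
      DFunLike.congr_fun (mem_kerContr_succ.1 hF) _
    have h2 := neg_one_pow_smul_cons_removeNth F x g l
    rw [h1, smul_zero, ← h, Function.update_eq_self] at h2
    exact h2.symm

variable {k P : Type*} [Field k] [PartialOrder P] [Fintype P] [DecidableEq P]

/-- The determinant of the arguments of a form with respect to the edges of a chain, times a fixed
element `y`. -/
def chainForm {m : ℕ} (c : Chain P (m + 1)) (y : lieAlg k P) :
    lieAlg k P [⋀^Fin m]→ₗ[k] lieAlg k P :=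
  (LinearMap.toSpanSingleton k (lieAlg k P) y).compAlternatingMap
    (Matrix.detRowAlternating.compLinearMap
      (LinearMap.pi fun i : Fin m => entry (c.vertex i.castSucc) (c.vertex i.succ)))

theorem chainForm_apply {m : ℕ} (c : Chain P (m + 1)) (y : lieAlg k P) (g : Fin m → lieAlg k P) :
    chainForm c y g =
      (Matrix.of fun j i => entry (c.vertex i.castSucc) (c.vertex i.succ) (g j)).det • y := rfl

theorem chainEval_chainForm_self {m : ℕ} (c : Chain P (m + 1)) (y : lieAlg k P) :
    chainEval (chainForm c y) c = entry (c.vertex 0) (c.vertex (Fin.last m)) y := by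
  have h : (Matrix.of fun j i : Fin m => (entry (c.vertex i.castSucc) (c.vertex i.succ)
      (units c j) : k)) = 1 := by
    ext j i
    have hinj : ∀ i j : Fin (m + 1), c.vertex i = c.vertex j ↔ i = j := fun i j => c.2.injective.eq_iff
    rw [Matrix.of_apply, units_apply, entry_unit, Matrix.one_apply]
    simp [hinj]
  rw [chainEval_apply, chainForm_apply, h, Matrix.det_one, one_smul]

/-- If every edge of `c` were an edge of `c'`, the chains would have the same vertices; otherwise
the determinant has a zero column. At least one edge is needed: on single vertices the determinant
is empty and equals 1. -/
theorem chainEval_chainForm_of_ne {m : ℕ} {c c' : Chain P (m + 2)} (h : c' ≠ c) (y : lieAlg k P) :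
    chainEval (chainForm c y) c' = 0 := by
  have h1 : ∃ i : Fin (m + 1), ∀ j : Fin (m + 1),
      ¬ (c'.vertex j.castSucc = c.vertex i.castSucc ∧ c'.vertex j.succ = c.vertex i.succ) := by
    by_contra hcon
    push Not at hcon
    refine h (Subtype.ext ((c'.2.range_inj c.2).1 (Eq.symm ?_)))
    have hsub : Set.range c.1 ⊆ Set.range c'.1 := by
      rintro _ ⟨l, rfl⟩
      cases l using Fin.lastCases with
      | last =>
        obtain ⟨j, -, hj⟩ := hcon (Fin.last m)
        exact ⟨j.succ, hj⟩
      | cast l =>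
        obtain ⟨j, hj, -⟩ := hcon l
        exact ⟨j.castSucc, hj⟩
    refine Set.eq_of_subset_of_ncard_le hsub ?_
    rw [← Set.image_univ, ← Set.image_univ, Set.ncard_image_of_injective _ c.2.injective,
      Set.ncard_image_of_injective _ c'.2.injective]
  obtain ⟨i, hi⟩ := h1
  rw [chainEval_apply, chainForm_apply, Matrix.det_eq_zero_of_column_eq_zero i, zero_smul, map_zero]
  intro j
  rw [Matrix.of_apply, units_apply, entry_unit, if_neg (hi j)]

theorem chainForm_mem_kerContr {m : ℕ} (c : Chain P (m + 1)) (y : lieAlg k P) {x : lieAlg k P}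
    (hx : ∀ a b, a ≠ b → entry a b x = 0) : chainForm c y ∈ kerContr x m := by
  cases m with
  | zero => trivial
  | succ m =>
    refine AlternatingMap.ext fun g => ?_
    rw [contr_apply, chainForm_apply, Matrix.det_eq_zero_of_row_eq_zero 0, zero_smul]
    · rfl
    · intro i
      rw [Matrix.of_apply, Fin.cons_zero]
      exact hx _ _ (c.vertex_lt Fin.castSucc_lt_succ).ne

variable (hN : (Fintype.card P : k) ≠ 0)

theorem entry_cartanEl_of_ne (i : P) {a b : P} (h : a ≠ b) : entry a b (cartanEl hN i) = 0 := by
  rw [cartanEl, entry_diagEl, if_neg h]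

/-- Where the form is nonzero on weight vectors, its arguments are exactly the edges of the chain in
some order. Their weights telescope to the weight assumed for `y`. -/
theorem lieDer_chainForm {m : ℕ} (c : Chain P (m + 1)) (y : lieAlg k P) (p : P)
    (hy : ⁅cartanEl hN p, y⁆ = (((if c.vertex 0 = p then 1 else 0) -
      (if c.vertex (Fin.last m) = p then 1 else 0) : ℤ) : k) • y) :
    lieDer (cartanEl hN p) (chainForm c y) = 0 := by
  refine form_ext_weightVec hN fun x => ?_
  rw [lieDer_apply]
  have h : ∀ l, chainForm c y (Function.update (fun l => weightVec hN (x l)) l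
      ⁅cartanEl hN p, weightVec hN (x l)⁆) =
      (weight p (x l) : k) • chainForm c y fun l => weightVec hN (x l) := by
    intro l
    rw [cartanEl_lie_weightVec, AlternatingMap.map_update_smul, Function.update_eq_self]
  simp only [h, ← Finset.sum_smul]
  have h0 : ⁅cartanEl hN p, chainForm c y fun l => weightVec hN (x l)⁆ =
      (((if c.vertex 0 = p then 1 else 0) -
      (if c.vertex (Fin.last m) = p then 1 else 0) : ℤ) : k) •
        chainForm c y fun l => weightVec hN (x l) := by
    rw [chainForm_apply, lie_smul, hy, smul_comm]
  rw [h0, ← sub_smul]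
  by_cases hdet : (chainForm c y fun l => weightVec hN (x l)) = 0
  · rw [hdet, smul_zero]
  have h1 : ∀ i : Fin m, ∃ j : Fin m, x j = Sum.inr
      ⟨(c.vertex i.castSucc, c.vertex i.succ), c.vertex_lt Fin.castSucc_lt_succ⟩ := by
    intro i
    by_contra hcon
    push Not at hcon
    refine hdet ?_
    rw [chainForm_apply, Matrix.det_eq_zero_of_column_eq_zero i, zero_smul]
    intro j
    rw [Matrix.of_apply]
    rcases hx : x j with q | ⟨⟨e1, e2⟩, he⟩
    · exact entry_cartanEl_of_ne hN q (c.vertex_lt Fin.castSucc_lt_succ).ne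
    · rw [weightVec, entry_unit, if_neg]
      rintro ⟨rfl, rfl⟩
      exact hcon j hx
  choose τ hτ using h1
  have hinj : Function.Injective τ := by
    intro i j hij
    have h2 := (hτ i).symm.trans ((congrArg x hij).trans (hτ j))
    simp only [Sum.inr.injEq, Subtype.mk.injEq, Prod.mk.injEq] at h2
    exact Fin.castSucc_injective _ (c.2.injective h2.1)
  have hsum : ∑ l, weight p (x l) = (if c.vertex 0 = p then 1 else 0) -
      (if c.vertex (Fin.last m) = p then 1 else 0) := by
    rw [← (Equiv.ofBijective τ (Finite.injective_iff_bijective.1 hinj)).sum_comp]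
    simp only [Equiv.ofBijective_apply, hτ, weight]
    rw [Finset.sum_sub_distrib, sub_eq_sub_iff_add_eq_add]
    rw [← Fin.sum_univ_castSucc (fun l : Fin (m + 1) => if c.vertex l = p then (1 : ℤ) else 0),
      Fin.sum_univ_succ]
  rw [← Int.cast_sum, hsum, sub_self, zero_smul]

/-- Omitting `p₀` loses nothing, as the elements `cartanEl` sum to zero. -/
theorem mem_kerContr_of_mem_relForms {n : ℕ} {p₀ : P}
    {F : lieAlg k P [⋀^Fin n]→ₗ[k] lieAlg k P}
    (hF : F ∈ relForms (cartanEl hN) (Finset.univ.erase p₀) n) (i : P) :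
    F ∈ kerContr (cartanEl hN i) n := by
  rw [mem_relForms] at hF
  by_cases hi : i = p₀
  · subst hi
    cases n with
    | zero => trivial
    | succ n =>
      have h : cartanEl hN i = - ∑ j ∈ Finset.univ.erase i, cartanEl hN j := by
        rw [eq_neg_iff_add_eq_zero, Finset.add_sum_erase _ _ (Finset.mem_univ i), sum_cartanEl]
      rw [mem_kerContr_succ, h]
      change F.curryLeft _ = 0
      rw [map_neg, map_sum, Finset.sum_eq_zero, neg_zero]
      exact fun j hj => mem_kerContr_succ.1 (hF.2 j hj)
  · exact hF.2 i (Finset.mem_erase.2 ⟨hi, Finset.mem_univ i⟩)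

theorem eq_zero_of_chainEval_eq_zero
    (hk : ringChar k = 0 ∨ Fintype.card P < ringChar k) {n : ℕ} {p₀ : P}
    {F : lieAlg k P [⋀^Fin n]→ₗ[k] lieAlg k P}
    (hF : F ∈ relForms (cartanEl hN) (Finset.univ.erase p₀) n) (h : chainEval F = 0) : F = 0 := by
  refine form_ext_weightVec hN fun x => ?_
  by_cases hx : ∃ l i, x l = Sum.inl i
  · obtain ⟨l, i, hl⟩ := hx
    refine apply_eq_zero_of_mem_kerContr (mem_kerContr_of_mem_relForms hN hF i) (l := l) ?_
    rw [hl]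
    rfl
  have hx' : ∀ l, ∃ e, x l = Sum.inr e := by
    intro l
    rcases hl : x l with i | e
    · exact absurd ⟨l, i, hl⟩ hx
    · exact ⟨e, rfl⟩
  choose e he using hx'
  obtain rfl : x = fun l => Sum.inr (e l) := funext he
  by_cases hinj : Function.Injective e
  swap
  · refine F.map_eq_zero_of_not_injective _ fun h' => hinj fun l l' hl => h' ?_
    simp only [hl]
  refine ext_entry fun a b => ?_
  rw [map_zero]
  by_cases hw : ∀ p, (formWeight p (fun l => Sum.inr (e l)) a b : k) = 0
  swap
  · push Not at hw
    obtain ⟨p, hp⟩ := hw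
    have h1 := entry_lieDer_weightVec hN p (fun l => Sum.inr (e l)) F a b
    rw [(mem_relForms.1 hF).1 p, AlternatingMap.zero_apply, map_zero] at h1
    exact (mul_eq_zero.1 h1.symm).resolve_left hp
  have hei : Function.Injective fun l => (e l).1 := Subtype.val_injective.comp hinj
  -- All weights vanish in `k`; the bounds on the counts turn this into a balance of natural
  -- numbers, so the arguments are the edges of a chain from `a` to `b`.
  obtain ⟨c, hc0, hcl, σ, hσ⟩ := exists_chain_of_flow n (fun l => (e l).1) (fun l => (e l).2) a b
    (fun p => by
      refine natCast_injOn_of_le hk (sum_edges_le (fun l => (e l).2) hei p b).1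
        (sum_edges_le (fun l => (e l).2) hei p a).2 ?_
      have h1 := hw p
      simp only [formWeight, weight, Finset.sum_sub_distrib] at h1
      push_cast at h1 ⊢
      linear_combination -h1)
  have h2 : chainEval F c = 0 := by rw [h]; rfl
  have h3 : (units c : Fin n → lieAlg k P) = (fun l => weightVec hN (Sum.inr (e l))) ∘ σ := by
    funext l
    exact unit_congr (congrArg Prod.fst (hσ l)).symm (congrArg Prod.snd (hσ l)).symm _
      (e (σ l)).2
  have hc0' : c.vertex 0 = a := hc0
  have hcl' : c.vertex (Fin.last n) = b := hcl
  rw [chainEval_apply, h3, F.map_perm, hc0', hcl', Units.smul_def, map_zsmul] at h2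
  rcases Int.units_eq_one_or (Equiv.Perm.sign σ) with hs | hs
  · simpa [hs] using h2
  · simpa [hs] using h2

/-- The forms `chainForm c` with coefficient the unit from the first to the last vertex of `c` are
relative and dual to the chains. In degree 0 the two vertices coincide and no such unit exists. -/
theorem map_chainEval_relForms_succ (p₀ : P) (m : ℕ) :
    (relForms (cartanEl hN) (Finset.univ.erase p₀) (m + 1)).map chainEval = ⊤ := by
  classical
  have : Fintype (Chain P (m + 1 + 1)) := Fintype.ofInjective (fun c => c.1) Subtype.val_injective
  rw [eq_top_iff]
  rintro f -
  have hlt : ∀ c : Chain P (m + 1 + 1), c.vertex 0 < c.vertex (Fin.last (m + 1)) :=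
    fun c => c.vertex_lt (by simp [Fin.lt_def])
  refine ⟨∑ c, f c • chainForm c (unit (hlt c)), Submodule.sum_mem _ fun c _ =>
    Submodule.smul_mem _ _ (mem_relForms.2 ⟨fun p => ?_, fun p _ => ?_⟩), ?_⟩
  · refine lieDer_chainForm hN c _ p ?_
    rw [cartanEl, diagEl_lie_unit]
    simp [Pi.single_apply]
  · exact chainForm_mem_kerContr c _ fun a b => entry_cartanEl_of_ne hN p
  · funext c
    rw [map_sum, Finset.sum_apply, Finset.sum_eq_single c]
    · rw [map_smul, Pi.smul_apply, chainEval_chainForm_self, entry_unit, if_pos ⟨rfl, rfl⟩,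
        smul_eq_mul, mul_one]
    · intro c' _ hc'
      rw [map_smul, Pi.smul_apply, chainEval_chainForm_of_ne hc'.symm, smul_zero]
    · simp

end RelativeCochains

end LiePoset

namespace LiePoset

/-! ### Low-dimensional cochains of the nerve -/

section Nerve

variable {k P : Type*} [Field k] [PartialOrder P]

instance finite_chain [Finite P] (m : ℕ) : Finite (Chain P m) :=
  Finite.of_injective (fun c => c.1) Subtype.val_injective

/-- The chain with a single vertex. -/
def pointChain (p : P) : Chain P 1 := ⟨fun _ => p, Subsingleton.strictMono (α := Fin 1) _⟩

theorem eq_pointChain (c : Chain P 1) : c = pointChain (c.vertex 0) :=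
  Chain.ext_vertex fun l => by rw [Subsingleton.elim l 0]; rfl

/-- The empty chain. -/
def emptyChain : Chain P 0 := ⟨fun l => l.elim0, fun l => l.elim0⟩

theorem eq_emptyChain (c : Chain P 0) : c = emptyChain :=
  Chain.ext_vertex fun l => l.elim0

theorem nerveDelta_zero_apply (f : Chain P 0 → k) (c : Chain P 1) :
    nerveDelta k P 0 f c = f emptyChain := by
  rw [nerveDelta_apply]
  simp [eq_emptyChain (c.face 0)]

theorem nerveDelta_one_nerveDelta_zero (f : Chain P 0 → k) :
    nerveDelta k P 1 (nerveDelta k P 0 f) = 0 := by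
  funext c
  rw [nerveDelta_apply, Fin.sum_univ_two, nerveDelta_zero_apply, nerveDelta_zero_apply]
  simp

theorem subsingleton_augNerveCohomologyNegOne [Nonempty P] :
    Subsingleton (augNerveCohomologyNegOne k P) := by
  refine subsingleton_of_forall_eq 0 fun f => Subtype.ext (funext fun c => ?_)
  obtain ⟨p⟩ := ‹Nonempty P›
  have h := congrFun (LinearMap.mem_ker.1 f.2) (pointChain p)
  rw [nerveDelta_zero_apply] at h
  rw [eq_emptyChain c]
  exact h

end Nerve

/-! ### Comparison of the relative complex with the augmented nerve -/

section Comparison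

open Module

variable {k P : Type*} [Field k] [PartialOrder P] [Fintype P] [DecidableEq P]
  (hN : (Fintype.card P : k) ≠ 0)

/-- Relative 0-cochains are the traceless diagonal matrices, the $(-1)$-simplex contributes the
constants, and $N\ne0$ in $\mathbf k$ makes these complementary among functions on $P$. -/
theorem isCompl_map_chainEval_relForms_zero (p₀ : P) :
    IsCompl ((relForms (cartanEl hN) (Finset.univ.erase p₀) 0).map chainEval)
      (LinearMap.range (nerveDelta k P 0)) := by
  refine ⟨Submodule.disjoint_def.2 ?_, codisjoint_iff.2 (eq_top_iff.2 ?_)⟩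
  · rintro _ ⟨F, -, rfl⟩ ⟨u, hu⟩
    have h1 : ∀ p : P, entry p p (F Fin.elim0) = u emptyChain := by
      intro p
      rw [← nerveDelta_zero_apply u (pointChain p), hu, chainEval_apply]
      exact congrArg _ (congrArg F (Subsingleton.elim _ _))
    have h2 := sum_entry_diag (F Fin.elim0)
    simp only [h1, Finset.sum_const, Finset.card_univ, nsmul_eq_mul] at h2
    funext c
    rw [← hu, nerveDelta_zero_apply]
    exact (mul_eq_zero.1 h2).resolve_left hN
  · rintro f -
    let t : P → k := fun p => f (pointChain p)
    have h1 : chainForm (pointChain p₀) (diagEl hN t) ∈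
        relForms (cartanEl hN) (Finset.univ.erase p₀) 0 := by
      refine mem_relForms.2 ⟨fun p => lieDer_chainForm hN _ _ p ?_, fun _ _ => trivial⟩
      rw [cartanEl, diagEl_lie_diagEl]
      simp
    have h2 : f = chainEval (chainForm (pointChain p₀) (diagEl hN t)) +
        nerveDelta k P 0 (fun _ => (Fintype.card P : k)⁻¹ * ∑ j, t j) := by
      funext c
      have h3 : chainForm (pointChain p₀) (diagEl hN t) (units c) = diagEl hN t := by
        rw [chainForm_apply, Matrix.det_fin_zero, one_smul]
      rw [Pi.add_apply, nerveDelta_zero_apply, chainEval_apply, h3, entry_diagEl,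
        if_pos (show c.vertex 0 = c.vertex (Fin.last 0) from rfl), sub_add_cancel]
      exact congrArg f (eq_pointChain c)
    rw [h2]
    exact Submodule.add_mem_sup ⟨_, h1, rfl⟩ ⟨_, rfl⟩

theorem ceD_mem_relForms {p₀ : P} {n : ℕ} {F : lieAlg k P [⋀^Fin n]→ₗ[k] lieAlg k P}
    (hF : F ∈ relForms (cartanEl hN) (Finset.univ.erase p₀) n) :
    ceD F ∈ relForms (cartanEl hN) (Finset.univ.erase p₀) (n + 1) := by
  rw [mem_relForms] at hF ⊢
  refine ⟨fun p => by rw [← ceD_lieDer, hF.1 p, map_zero], fun p hp => ?_⟩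
  rw [mem_kerContr_succ]
  cases n with
  | zero => rw [contr_ceD_zero, hF.1 p]
  | succ n =>
    rw [contr_ceD_succ, hF.1 p, mem_kerContr_succ.1 (hF.2 p hp), map_zero, sub_zero]

/-- Inherited from $d^2=0$ on Lie algebra cochains, since `chainEval` is onto up to constants in the
lowest degree. -/
theorem nerveDelta_nerveDelta [Nonempty P] (hN : (Fintype.card P : k) ≠ 0) (m : ℕ)
    (f : Chain P m → k) :
    nerveDelta k P (m + 1) (nerveDelta k P m f) = 0 := by
  obtain ⟨p₀⟩ := ‹Nonempty P›
  cases m with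
  | zero => exact nerveDelta_one_nerveDelta_zero f
  | succ m =>
    have h : ∀ F : lieAlg k P [⋀^Fin m]→ₗ[k] lieAlg k P,
        nerveDelta k P (m + 2) (nerveDelta k P (m + 1) (chainEval F)) = 0 := by
      intro F
      rw [← chainEval_ceD, ← chainEval_ceD, ceD_ceD, map_zero]
    cases m with
    | zero =>
      have h1 := (isCompl_map_chainEval_relForms_zero hN p₀).sup_eq_top
      obtain ⟨_, ⟨F, -, rfl⟩, _, ⟨u, rfl⟩, rfl⟩ :=
        Submodule.mem_sup.1 (h1 ▸ Submodule.mem_top : f ∈ _)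
      rw [map_add, map_add, h, nerveDelta_one_nerveDelta_zero, map_zero, add_zero]
    | succ m =>
      obtain ⟨F, -, rfl⟩ : f ∈ (relForms (cartanEl hN) (Finset.univ.erase p₀) (m + 1)).map
          chainEval := by
        rw [map_chainEval_relForms_succ]
        trivial
      exact h F

variable (hk : ringChar k = 0 ∨ Fintype.card P < ringChar k)
include hk

theorem finrank_relForms (p₀ : P) (n : ℕ) :
    finrank k (relForms (k := k) (M := lieAlg k P) (cartanEl hN) (Finset.univ.erase p₀) n) =
      finrank k ((relForms (cartanEl hN) (Finset.univ.erase p₀) n).map chainEval) :=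
  (finrank_map_of_injOn _ _ fun _ hF h => eq_zero_of_chainEval_eq_zero hN hk hF h).symm

/-- Relative cochains are stable under `ceD`, so `chainEval` is injective on the image too. The
constants missing in degree 0 are killed by the nerve coboundary. -/
theorem finrank_map_ceD_relForms (p₀ : P) (n : ℕ) :
    finrank k ((relForms (k := k) (M := lieAlg k P) (cartanEl hN)
      (Finset.univ.erase p₀) n).map ceD) =
      finrank k (LinearMap.range (nerveDelta k P (n + 1))) := by
  have h1 : (((relForms (k := k) (M := lieAlg k P) (cartanEl hN)
      (Finset.univ.erase p₀) n).map ceD).map chainEval) =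
      ((relForms (cartanEl hN) (Finset.univ.erase p₀) n).map chainEval).map
        (nerveDelta k P (n + 1)) := by
    rw [← Submodule.map_comp, ← Submodule.map_comp]
    congr 1
    ext1 F
    exact chainEval_ceD F
  rw [← finrank_map_of_injOn chainEval, h1]
  · cases n with
    | zero =>
      have h2 := (isCompl_map_chainEval_relForms_zero hN p₀).sup_eq_top
      rw [LinearMap.range_eq_map (nerveDelta k P (0 + 1)), ← h2, Submodule.map_sup]
      have h3 : (LinearMap.range (nerveDelta k P 0)).map (nerveDelta k P (0 + 1)) = ⊥ := by
        rw [eq_bot_iff]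
        rintro _ ⟨_, ⟨u, rfl⟩, rfl⟩
        exact nerveDelta_one_nerveDelta_zero u
      rw [h3, sup_bot_eq]
    | succ n => rw [map_chainEval_relForms_succ, LinearMap.range_eq_map]
  · rintro _ ⟨F, hF, rfl⟩ h
    exact eq_zero_of_chainEval_eq_zero hN hk (ceD_mem_relForms hN hF) h

theorem finrank_augNerveCohomology (p₀ : P) (q : ℕ) :
    (finrank k (augNerveCohomology k P q) : ℤ) =
      cohomDim (relForms (k := k) (M := lieAlg k P) (cartanEl hN) (Finset.univ.erase p₀)) q := by
  have : Nonempty P := ⟨p₀⟩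
  rw [finrank_quotient_submoduleOf]
  · have h1 := LinearMap.finrank_range_add_finrank_ker (nerveDelta k P (q + 1))
    cases q with
    | zero =>
      have h2 := Submodule.finrank_add_eq_of_isCompl (isCompl_map_chainEval_relForms_zero hN p₀)
      rw [cohomDim, finrank_relForms hN hk, finrank_map_ceD_relForms hN hk]
      omega
    | succ q =>
      have h2 := finrank_relForms hN hk p₀ (q + 1)
      rw [map_chainEval_relForms_succ, finrank_top] at h2
      rw [cohomDim, finrank_map_ceD_relForms hN hk, finrank_map_ceD_relForms hN hk]
      omega
  · rintro _ ⟨f, rfl⟩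
    exact nerveDelta_nerveDelta hN _ f

include hN in
theorem finrank_adjointCohomology [Nonempty P] (n : ℕ) :
    finrank k (adjointCohomology k P n) = ∑ x ∈ Finset.HasAntidiagonal.antidiagonal n,
      (Fintype.card P - 1).choose x.1 * finrank k (augNerveCohomology k P x.2) := by
  obtain ⟨p₀⟩ := ‹Nonempty P›
  have hcomm : ∀ i j, ⁅cartanEl hN i, cartanEl hN j⁆ = 0 := fun i j => diagEl_lie_diagEl hN _ _
  -- Subtracting the entry at `p₀` cancels the correction $-1/N$ in `cartanEl`, making these forms
  -- dual to it away from `p₀`.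
  let ξ : P → lieAlg k P →ₗ[k] k := fun i => entry i i - entry p₀ p₀
  have hξ : ∀ i, ∀ y z : lieAlg k P, ξ i ⁅y, z⁆ = 0 := fun i y z => by
    simp [ξ, entry_diag_lie]
  have hs : ∀ i ∈ Finset.univ.erase p₀, ∀ j ∈ Finset.univ.erase p₀,
      ξ i (cartanEl hN j) = if i = j then 1 else 0 := by
    intro i hi j hj
    simp only [ξ, cartanEl, LinearMap.sub_apply, entry_diagEl, if_true, Pi.single_apply]
    simp [(Finset.ne_of_mem_erase hj).symm]
  have h1 := cohomSeries_relForms (M := lieAlg k P) hcomm hξ (Finset.univ.erase p₀) hs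
  have h2 := congrArg (PowerSeries.coeff n) h1
  have h3 : PowerSeries.coeff n (cohomSeries (invForms (k := k) (M := lieAlg k P) (cartanEl hN)
      Finset.univ)) = finrank k (adjointCohomology k P n) := by
    rw [cohomSeries, PowerSeries.coeff_mk, finrank_ceCohomology,
      cohomDim_invForms hcomm (fun i => cartanEl_semisimple hN i)]
  have h4 : ∀ m p : ℕ, PowerSeries.coeff p ((1 + PowerSeries.X : PowerSeries ℤ) ^ m) =
      m.choose p := by
    intro m p
    rw [← Polynomial.coeff_one_add_X_pow ℤ m p, ← Polynomial.coeff_coe]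
    simp
  rw [h3, PowerSeries.coeff_mul, Finset.card_erase_of_mem (Finset.mem_univ _),
    Finset.card_univ] at h2
  simp only [h4, cohomSeries, PowerSeries.coeff_mk, ← finrank_augNerveCohomology hN hk] at h2
  exact_mod_cast h2

end Comparison

end LiePoset

namespace LiePoset

/-! ### The exterior algebra of $\mathfrak h^\vee$ as cohomology of $\mathfrak h$ -/

section Cartan

open Module

/-- The pairing sends the exterior basis of the dual basis to the dual of the exterior basis. -/
theorem pairingDual_bijective {k V : Type*} [Field k] [AddCommGroup V] [Module k V]
    [FiniteDimensional k V] (p : ℕ) :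
    Function.Bijective (exteriorPower.pairingDual k V p) := by
  classical
  let b := Module.finBasis k V
  have h : exteriorPower.pairingDual k V p =
      ((b.dualBasis.exteriorPower p).equiv (b.exteriorPower p).dualBasis (Equiv.refl _)).toLinearMap := by
    refine (b.dualBasis.exteriorPower p).ext fun s => ?_
    rw [LinearEquiv.coe_coe, Basis.equiv_apply, exteriorPower.basis_apply, Basis.coe_dualBasis,
      Basis.coe_dualBasis, exteriorPower.basis_coord]
    rfl
  rw [h]
  exact LinearEquiv.bijective _

variable {k P : Type*} [Field k] [Fintype P] [DecidableEq P]

theorem cartan_lie_eq_zero (x y : cartan k P) : ⁅x, y⁆ = 0 := by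
  refine Subtype.ext ?_
  change (⁅x.1, y.1⁆ : Matrix P P k) = 0
  rw [Ring.lie_def, ← x.2.1.diagonal_diag, ← y.2.1.diagonal_diag, Matrix.diagonal_mul_diagonal,
    Matrix.diagonal_mul_diagonal, sub_eq_zero]
  congr 1
  funext i
  exact mul_comm _ _

theorem ceDelta_cartan (n : ℕ)
    (F : cartan k P [⋀^Fin n]→ₗ[k] TrivialLieModule k (cartan k P) k) :
    ceDelta k (cartan k P) (TrivialLieModule k (cartan k P) k) n F = 0 := by
  funext g
  simp only [ceDelta, LinearMap.coe_mk, AddHom.coe_mk, trivial_lie_zero, smul_zero,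
    Finset.sum_const_zero, zero_add, Pi.zero_apply]
  cases n with
  | zero => rfl
  | succ n =>
    refine Finset.sum_eq_zero fun j _ => Finset.sum_eq_zero fun i _ => ?_
    rw [cartan_lie_eq_zero, F.map_coord_zero 0 (Fin.cons_zero _ _), smul_zero, ite_self]

theorem ceCocycles_cartan (n : ℕ) :
    ceCocycles k (cartan k P) (TrivialLieModule k (cartan k P) k) n = ⊤ := by
  rw [eq_top_iff]
  exact fun F _ => ceDelta_cartan n F

theorem ceCoboundaries_cartan (n : ℕ) :
    ceCoboundaries k (cartan k P) (TrivialLieModule k (cartan k P) k) n = ⊥ := by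
  cases n with
  | zero => rfl
  | succ n =>
    rw [eq_bot_iff]
    rintro F ⟨G, hG⟩
    refine AlternatingMap.ext fun g => ?_
    rw [hG, ceDelta_cartan]
    rfl

/-- The identification of `⋀ 𝔥^∨` with the alternating forms on `𝔥`. -/
noncomputable def cartanDualPowerEquivForms (p : ℕ) : cartanDualPower k P p ≃ₗ[k]
    (cartan k P [⋀^Fin p]→ₗ[k] TrivialLieModule k (cartan k P) k) :=
  (LinearEquiv.ofBijective _ (pairingDual_bijective p)).trans
    (exteriorPower.alternatingMapLinearEquiv (R := k) (M := cartan k P)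
      (N := TrivialLieModule k (cartan k P) k)).symm

theorem cartanDualPowerEquivForms_ιMulti (p : ℕ) (ξ : Fin p → Module.Dual k (cartan k P))
    (h : Fin p → cartan k P) :
    TrivialLieModule.equiv k (cartan k P) k
      (cartanDualPowerEquivForms p (exteriorPower.ιMulti k p ξ) h) =
        (Matrix.of fun i j => ξ i (h j)).det := by
  rw [← Matrix.det_transpose]
  exact exteriorPower.pairingDual_ιMulti_ιMulti ξ h

/-- The identification of `⋀ 𝔥^∨` with `H^*(𝔥, k)`. -/
noncomputable def cartanDualPowerEquiv (p : ℕ) :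
    cartanDualPower k P p ≃ₗ[k] cartanCohomology k P p :=
  ((cartanDualPowerEquivForms p).trans
    ((LinearEquiv.ofEq _ _ (ceCocycles_cartan p)).trans Submodule.topEquiv).symm).trans
    (Submodule.quotEquivOfEqBot _ (by
      rw [ceCoboundaries_cartan, Submodule.submoduleOf, Submodule.comap_bot,
        Submodule.ker_subtype])).symm

theorem finrank_cartan [Nonempty P] : finrank k (cartan k P) = Fintype.card P - 1 := by
  let s : (P → k) →ₗ[k] k := Fintype.linearCombination k (fun _ => 1)
  have hs : LinearMap.range s = ⊤ := by
    rw [LinearMap.range_eq_top]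
    intro a
    obtain ⟨p⟩ := ‹Nonempty P›
    exact ⟨Pi.single p a, by simp [s, Fintype.linearCombination_apply_single]⟩
  have h1 := LinearMap.finrank_range_add_finrank_ker s
  rw [hs, finrank_top, finrank_self, finrank_fintype_fun_eq_card] at h1
  let f : cartan k P →ₗ[k] (P → k) :=
    { toFun := fun x i => x.1 i i
      map_add' := fun _ _ => rfl
      map_smul' := fun _ _ => rfl }
  have hf : Function.Injective f := by
    intro x y hxy
    refine Subtype.ext ?_
    rw [← x.2.1.diagonal_diag, ← y.2.1.diagonal_diag]
    exact congrArg _ hxy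
  have hr : LinearMap.range f = LinearMap.ker s := by
    ext t
    constructor
    · rintro ⟨x, rfl⟩
      change s (fun i => x.1 i i) = 0
      have := x.2.2
      simpa [s, Fintype.linearCombination_apply, Matrix.trace] using this
    · intro ht
      refine ⟨⟨Matrix.diagonal t, Matrix.isDiag_diagonal t, ?_⟩, ?_⟩
      · simpa [s, Fintype.linearCombination_apply] using ht
      · funext i
        exact Matrix.diagonal_apply_eq t i
  rw [← LinearMap.finrank_range_of_inj hf, hr]
  omega

theorem finrank_cartanDualPower [Nonempty P] (p : ℕ) :
    finrank k (cartanDualPower k P p) = (Fintype.card P - 1).choose p := by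
  rw [exteriorPower.finrank_eq, Subspace.dual_finrank_eq, finrank_cartan]

end Cartan

/-! ### From dimensions to isomorphisms -/

section Main

open Module

theorem nonempty_equiv_tensor_prod {k A X Y Z W V : Type*} [Field k] [AddCommGroup A] [Module k A]
    [AddCommGroup X] [Module k X] [AddCommGroup Y] [Module k Y] [AddCommGroup Z] [Module k Z]
    [AddCommGroup W] [Module k W] [AddCommGroup V] [Module k V] [FiniteDimensional k A]
    [FiniteDimensional k X] [FiniteDimensional k Y] [FiniteDimensional k Z]
    [FiniteDimensional k W] [FiniteDimensional k V]
    (h : finrank k A = finrank k X * finrank k Y + (finrank k Z * finrank k W + finrank k V)) :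
    Nonempty (A ≃ₗ[k] (X ⊗[k] Y) × (Z ⊗[k] W) × V) := by
  refine FiniteDimensional.nonempty_linearEquiv_of_finrank_eq ?_
  rw [h, finrank_prod, finrank_prod, finrank_tensorProduct, finrank_tensorProduct]

theorem finrank_ceCohomology_zero {k L : Type*} [Field k] [LieRing L] [LieAlgebra k L]
    [FiniteDimensional k L] :
    finrank k (ceCohomology k L L 0) = finrank k (LieAlgebra.center k L) := by
  have h1 := finrank_ceCohomology (k := k) (L := L) (M := L) 0
  rw [cohomDim_zero, top_inf_eq] at h1
  have h2 : (LieAlgebra.center k L).toSubmodule.map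
      (AlternatingMap.constLinearEquivOfIsEmpty : L ≃ₗ[k] (L [⋀^Fin 0]→ₗ[k] L)).toLinearMap =
      LinearMap.ker ceD := by
    ext F
    obtain ⟨y, rfl⟩ := (AlternatingMap.constLinearEquivOfIsEmpty :
      L ≃ₗ[k] (L [⋀^Fin 0]→ₗ[k] L)).surjective F
    have h3 : ceD (AlternatingMap.constLinearEquivOfIsEmpty y : L [⋀^Fin 0]→ₗ[k] L) = 0 ↔
        ∀ x : L, ⁅x, y⁆ = 0 := by
      constructor
      · intro h x
        have h4 := contr_ceD_zero x (AlternatingMap.constLinearEquivOfIsEmpty y : L [⋀^Fin 0]→ₗ[k] L)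
        rw [h, map_zero] at h4
        have h5 := DFunLike.congr_fun h4 Fin.elim0
        rw [lieDer_apply] at h5
        simpa using h5.symm
      · intro h
        refine ext_contr fun x => AlternatingMap.ext fun g => ?_
        rw [contr_ceD_zero, lieDer_apply]
        simpa using h x
    rw [LinearMap.mem_ker]
    refine Iff.trans ?_ h3.symm
    rw [← LieModule.mem_maxTrivSubmodule (R := k)]
    constructor
    · rintro ⟨z, hz, h⟩
      rwa [← LinearEquiv.injective _ h]
    · exact fun h => ⟨y, h, rfl⟩
  rw [← h2, LinearEquiv.finrank_map_eq] at h1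
  exact_mod_cast h1

theorem card_cast_ne_zero {k P : Type*} [Field k] [Fintype P] [Nonempty P]
    (hk : ringChar k = 0 ∨ Fintype.card P < ringChar k) :
    (Fintype.card P : k) ≠ 0 := fun h =>
  Fintype.card_ne_zero (natCast_injOn_of_le hk le_rfl (Nat.zero_le _) (by rw [h, Nat.cast_zero]))

variable {k P : Type*} [Field k] [PartialOrder P] [Fintype P] [DecidableEq P]

/-- Stated for any family with binomial dimensions, so that it serves both $\bigwedge^p\mathfrak
h^\vee$ and $H^p(\mathfrak h,\mathbf k)$. -/
theorem nonempty_adjointCohomology_equiv [Nonempty P]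
    (hk : ringChar k = 0 ∨ Fintype.card P < ringChar k) (A : ℕ → Type*)
    [∀ p, AddCommGroup (A p)] [∀ p, Module k (A p)] [∀ p, Module.Finite k (A p)]
    (hA : ∀ p, finrank k (A p) = (Fintype.card P - 1).choose p) (n : ℕ) :
    Nonempty (adjointCohomology k P n ≃ₗ[k]
      ⨁ x : {x : ℕ × ℕ // x.1 + x.2 = n}, A x.1.1 ⊗[k] augNerveCohomology k P x.1.2) := by
  have hmem : ∀ x : ℕ × ℕ, x ∈ Finset.HasAntidiagonal.antidiagonal n ↔ x.1 + x.2 = n :=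
    fun x => Finset.HasAntidiagonal.mem_antidiagonal
  let : Fintype {x : ℕ × ℕ // x.1 + x.2 = n} :=
    Fintype.subtype (Finset.HasAntidiagonal.antidiagonal n) hmem
  refine FiniteDimensional.nonempty_linearEquiv_of_finrank_eq ?_
  rw [finrank_directSum, finrank_adjointCohomology (card_cast_ne_zero hk) hk,
    Finset.sum_subtype _ hmem]
  exact Finset.sum_congr rfl fun x _ => by rw [finrank_tensorProduct, hA]

end Main

end LiePoset

theorem theorem10 {k : Type*} [Field k] {P : Type*} [PartialOrder P] [Fintype P] [DecidableEq P]
    [Nonempty P] (hk : ringChar k = 0 ∨ Fintype.card P < ringChar k) :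
    -- `H^*(𝔤, 𝔤) ≅ ⋀ 𝔥^∨ ⊗ H^*(Σ⁺, k)` as graded vector spaces
    (∀ n : ℕ, Nonempty (LiePoset.adjointCohomology k P n ≃ₗ[k]
      ⨁ x : {x : ℕ × ℕ // x.1 + x.2 = n},
        LiePoset.cartanDualPower k P x.1.1 ⊗[k] LiePoset.augNerveCohomology k P x.1.2)) ∧
    -- there is no contribution from degree `-1`
    Subsingleton (LiePoset.augNerveCohomologyNegOne k P) ∧
    -- the identification `⋀ 𝔥^∨ = H^*(𝔥, k)`: the element `ξ₁ ∧ ⋯ ∧ ξ_p` is the class of the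
    -- alternating form `(h₁, …, h_p) ↦ det (ξ_i (h_j))`
    (∃ e : ∀ p : ℕ, LiePoset.cartanDualPower k P p ≃ₗ[k] LiePoset.cartanCohomology k P p,
      ∀ (p : ℕ) (ξ : Fin p → Module.Dual k (LiePoset.cartan k P)),
        ∃ z : LiePoset.ceCocycles k (LiePoset.cartan k P)
            (TrivialLieModule k (LiePoset.cartan k P) k) p,
          (∀ h : Fin p → LiePoset.cartan k P,
            TrivialLieModule.equiv k (LiePoset.cartan k P) k (z.1 h) =
              (Matrix.of fun i j => ξ i (h j)).det) ∧
          e p (exteriorPower.ιMulti k p ξ) = Submodule.Quotient.mk z) ∧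
    -- `H^*(𝔤, 𝔤) ≅ H^*(𝔥, k) ⊗ H^*(Σ⁺, k)` as graded vector spaces
    (∀ n : ℕ, Nonempty (LiePoset.adjointCohomology k P n ≃ₗ[k]
      ⨁ x : {x : ℕ × ℕ // x.1 + x.2 = n},
        LiePoset.cartanCohomology k P x.1.1 ⊗[k] LiePoset.augNerveCohomology k P x.1.2)) ∧
    -- `H²(𝔤, 𝔤) ≅ (⋀² 𝔥^∨ ⊗ 𝔠) ⊕ (𝔥^∨ ⊗ H¹(Σ, k)) ⊕ H²(Σ, k)`, with `𝔠` the center of `𝔤`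
    Nonempty (LiePoset.adjointCohomology k P 2 ≃ₗ[k]
      (LiePoset.cartanDualPower k P 2 ⊗[k] LieAlgebra.center k (LiePoset.lieAlg k P)) ×
      (Module.Dual k (LiePoset.cartan k P) ⊗[k] LiePoset.nerveCohomology k P 1) ×
      LiePoset.nerveCohomology k P 2) := by
  refine ⟨fun n => ?_, ?_, ⟨LiePoset.cartanDualPowerEquiv, fun p ξ => ?_⟩, fun n => ?_, ?_⟩
  · exact LiePoset.nonempty_adjointCohomology_equiv hk (LiePoset.cartanDualPower k P)
      LiePoset.finrank_cartanDualPower n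
  · exact LiePoset.subsingleton_augNerveCohomologyNegOne
  · refine ⟨⟨LiePoset.cartanDualPowerEquivForms p (exteriorPower.ιMulti k p ξ), ?_⟩,
      LiePoset.cartanDualPowerEquivForms_ιMulti p ξ, rfl⟩
    rw [LiePoset.ceCocycles_cartan]
    trivial
  · have : ∀ p, Module.Finite k (LiePoset.cartanCohomology k P p) := fun p =>
      Module.Finite.equiv (LiePoset.cartanDualPowerEquiv p)
    exact LiePoset.nonempty_adjointCohomology_equiv hk (LiePoset.cartanCohomology k P)
      (fun p => by
        rw [← (LiePoset.cartanDualPowerEquiv p).finrank_eq, LiePoset.finrank_cartanDualPower]) n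
  -- The center is $H^0(\mathfrak g,\mathfrak g)$, and the dimension formula in degree 0 has the
  -- single term $H^0(\Sigma^+)$. In positive degrees the augmentation changes nothing.
  · have h0 : Module.finrank k (LieAlgebra.center k (LiePoset.lieAlg k P)) =
        Module.finrank k (LiePoset.augNerveCohomology k P 0) := by
      rw [← LiePoset.finrank_ceCohomology_zero,
        LiePoset.finrank_adjointCohomology (LiePoset.card_cast_ne_zero hk) hk]
      simp
    have h1 : Module.finrank k (LiePoset.nerveCohomology k P 1) =
        Module.finrank k (LiePoset.augNerveCohomology k P 1) := rfl
    have h2 : Module.finrank k (LiePoset.nerveCohomology k P 2) =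
        Module.finrank k (LiePoset.augNerveCohomology k P 2) := rfl
    refine LiePoset.nonempty_equiv_tensor_prod ?_
    rw [LiePoset.finrank_adjointCohomology (LiePoset.card_cast_ne_zero hk) hk,
      LiePoset.finrank_cartanDualPower, Subspace.dual_finrank_eq, LiePoset.finrank_cartan, h0, h1,
      h2, Finset.Nat.sum_antidiagonal_eq_sum_range_succ_mk]
    simp [Finset.sum_range_succ]
    ring
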